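/- Let $n\ge 1$, let $\mathbb H_n$ be the Siegel upper half space of symmetric $Z=X+iY\in M_n(\mathbb C)$ with $Y>0$, and let $(\rho,V)$ be an irreducible finite-dimensional rational representation of $\mathrm{GL}_n(\mathbb C)$ whose highest weight is the tuple of integers $\lambda_1\ge\dots\ge\lambda_n$. Fix a $U(n)$-invariant inner product on $V$, with norm $\|v\|=\langle v,v\rangle^{1/2}$. For $F:\mathbb H_n\to V$ and $g=\begin{pmatrix}A&B\\C&D\end{pmatrix}\in\mathrm{Sp}_{2n}(\mathbb R)$ put $$(F|_\rho g)(Z)=\rho(CZ+D)^{-1}F\big((AZ+B)(CZ+D)^{-1}\big).$$ For an integer $p\ge0$ let $T_n^p$ be the set of families $b=(b_{ij})_{1\le i\le j\le n}$ of non-negative integers with $\sum b_{ij}\le p$, and put $[M]^b=\prod_{i\le j}m_{ij}^{b_{ij}}$ for a symmetric matrix $M=(m_{ij})$. Let $N^p(\mathbb H_n)$ be the space of functions $f(Z)=\sum_{b\in T_n^p}G_b(Z)[Y^{-1}]^b$ with $G_b$ holomorphic on $\mathbb H_n$. Such an $f$ has a nice Fourier expansion if there are an integer $N\ge1$ and complex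 numbers $a_b(S)$ with $$f(Z)=\sum_{b\in T_n^p}\ \sum_{\substack{S\in\frac1N M_n^{\mathrm{sym}}(\mathbb Z)\\ S\ge0}}a_b(S)\,e^{2\pi i\,\mathrm{Tr}(SZ)}\,[Y^{-1}]^b,$$ the sum converging absolutely, and uniformly on compact subsets of $\mathbb H_n$. A congruence subgroup of $\mathrm{Sp}_{2n}(\mathbb Q)$ is a subgroup commensurable with $\mathrm{Sp}_{2n}(\mathbb Z)$ that contains a principal congruence subgroup of $\mathrm{Sp}_{2n}(\mathbb Z)$. A function $F:\mathbb H_n\to V$ is a nearly holomorphic Siegel modular form of weight $\rho$ if there are a congruence subgroup $\Gamma$ and a $p\ge0$ such that $F|_\rho\gamma=F$ for all $\gamma\in\Gamma$ and such that, for all $g\in\mathrm{Sp}_{2n}(\mathbb Q)$ and all linear $L:V\to\mathbb C$, the function $L\circ(F|_\rho g)$ lies in $N^p(\mathbb H_n)$ and has a nice Fourier expansion (with the same $p$). Theorem. For every nearly holomorphic Siegel modular form $F$ of weight $\rho$ there is a constant $C_F$ such that for all $Z=X+iY\in\mathbb H_n$ $$\|\rho(Y^{1/2})F(Z)\|\le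 C_F\prod_{i=1}^n\big(\mu_i(Y)^{\lambda_1/2}+\mu_i(Y)^{-\lambda_1/2}\big),$$ where $Y^{1/2}$ is the positive definite square root of $Y$ and $\mu_1(Y),\dots,\mu_n(Y)$ are the eigenvalues of $Y$, with multiplicity. -/

import Mathlib

open Matrix

namespace SiegelModular

/-! ### Real positive definite matrices -/

/-- A real matrix is positive definite iff it is so as a complex matrix. -/
theorem posDef_map_ofReal_iff {n : ℕ} {Y : Matrix (Fin n) (Fin n) ℝ} :
    (open scoped ComplexOrder in (Y.map ((↑) : ℝ → ℂ)).PosDef) ↔ Y.PosDef := by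
  open scoped ComplexOrder MatrixOrder in
  constructor
  · intro h
    refine PosDef.of_dotProduct_mulVec_pos ?_ ?_
    · ext i j
      have := congrFun (congrFun h.1 i) j
      simpa [Matrix.conjTranspose_apply] using this
    · intro x hx
      have hx' : (fun i => (x i : ℂ)) ≠ 0 := by
        intro h0
        apply hx
        funext i
        simpa using congrFun h0 i
      have := h.dotProduct_mulVec_pos hx'
      have e : star (fun i => (x i : ℂ)) ⬝ᵥ (Y.map ((↑) : ℝ → ℂ) *ᵥ fun i => (x i : ℂ))
          = ((star x ⬝ᵥ (Y *ᵥ x) : ℝ) : ℂ) := by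
        simp [dotProduct, mulVec]
      rw [e] at this
      exact_mod_cast this
  · intro h
    have hs : (CFC.sqrt Y)ᴴ * CFC.sqrt Y = Y := by
      have h1 : (CFC.sqrt Y)ᴴ = CFC.sqrt Y := (CFC.sqrt_nonneg Y).posSemidef.1
      rw [h1]
      exact CFC.sqrt_mul_sqrt_self Y h.posSemidef.nonneg
    have hu : IsUnit (CFC.sqrt Y) := (CFC.isUnit_sqrt_iff Y h.posSemidef.nonneg).2 h.isUnit
    have hu' : IsUnit ((CFC.sqrt Y).map ((↑) : ℝ → ℂ)) :=
      hu.map (Complex.ofRealHom.mapMatrix (m := Fin n))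
    have e : Y.map ((↑) : ℝ → ℂ)
        = ((CFC.sqrt Y).map ((↑) : ℝ → ℂ))ᴴ * (CFC.sqrt Y).map ((↑) : ℝ → ℂ) := by
      conv_lhs => rw [← hs]
      ext i j
      simp [Matrix.mul_apply]
    rw [e]
    exact PosDef.conjTranspose_mul_self _ (Matrix.mulVec_injective_iff_isUnit.2 hu')

open scoped MatrixOrder in
/-- The positive definite square root `Y^{1/2}` of a positive definite real matrix `Y`, as an
element of `GL_n(ℂ)`. -/
noncomputable def posDefSqrt {n : ℕ} (Y : Matrix (Fin n) (Fin n) ℝ) (hY : Y.PosDef) :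
    GL (Fin n) ℂ :=
  (((CFC.isUnit_sqrt_iff Y hY.posSemidef.nonneg).2 hY.isUnit).map
    (Complex.ofRealHom.mapMatrix (m := Fin n))).unit

/-! ### The Siegel upper half space and the action of the symplectic group -/

/-- The Siegel upper half space `ℍ_n`, as a set of complex matrices. -/
def siegelSet (n : ℕ) : Set (Matrix (Fin n) (Fin n) ℂ) :=
  {Z | Zᵀ = Z ∧ (Z.map Complex.im).PosDef}

/-- The Siegel upper half space `ℍ_n` of degree `n`. -/
abbrev SiegelSpace (n : ℕ) : Type := siegelSet n

/-- The imaginary part `Y` of `Z = X + iY`. -/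
def imPart {n : ℕ} (Z : SiegelSpace n) : Matrix (Fin n) (Fin n) ℝ :=
  (Z : Matrix (Fin n) (Fin n) ℂ).map Complex.im

theorem imPart_posDef {n : ℕ} (Z : SiegelSpace n) : (imPart Z).PosDef := Z.2.2

/-- The block `A` of `g = (A B; C D)`, as a complex matrix. -/
def blockA {n : ℕ} (g : symplecticGroup (Fin n) ℝ) : Matrix (Fin n) (Fin n) ℂ :=
  (g : Matrix (Fin n ⊕ Fin n) (Fin n ⊕ Fin n) ℝ).toBlocks₁₁.map (↑)

/-- The block `B` of `g = (A B; C D)`, as a complex matrix. -/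
def blockB {n : ℕ} (g : symplecticGroup (Fin n) ℝ) : Matrix (Fin n) (Fin n) ℂ :=
  (g : Matrix (Fin n ⊕ Fin n) (Fin n ⊕ Fin n) ℝ).toBlocks₁₂.map (↑)

/-- The block `C` of `g = (A B; C D)`, as a complex matrix. -/
def blockC {n : ℕ} (g : symplecticGroup (Fin n) ℝ) : Matrix (Fin n) (Fin n) ℂ :=
  (g : Matrix (Fin n ⊕ Fin n) (Fin n ⊕ Fin n) ℝ).toBlocks₂₁.map (↑)

/-- The block `D` of `g = (A B; C D)`, as a complex matrix. -/
def blockD {n : ℕ} (g : symplecticGroup (Fin n) ℝ) : Matrix (Fin n) (Fin n) ℂ :=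
  (g : Matrix (Fin n ⊕ Fin n) (Fin n ⊕ Fin n) ℝ).toBlocks₂₂.map (↑)

theorem block_relations {n : ℕ} (g : symplecticGroup (Fin n) ℝ) :
    (blockA g)ᵀ * blockC g = (blockC g)ᵀ * blockA g ∧
    (blockB g)ᵀ * blockD g = (blockD g)ᵀ * blockB g ∧
    (blockA g)ᵀ * blockD g - (blockC g)ᵀ * blockB g = 1 ∧
    (blockD g)ᵀ * blockA g - (blockB g)ᵀ * blockC g = 1 := by
  have h := SymplecticGroup.map_mem g.2 Complex.ofRealHom
  rw [← Matrix.fromBlocks_toBlocks (Matrix.map _ _), SymplecticGroup.fromBlocks_mem_iff] at h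
  obtain ⟨h1, h2, h3⟩ := h
  refine ⟨h1, h2, h3, ?_⟩
  have h4 := congrArg Matrix.transpose h3
  rw [Matrix.transpose_sub, Matrix.transpose_mul, Matrix.transpose_mul, Matrix.transpose_transpose,
    Matrix.transpose_transpose, Matrix.transpose_one] at h4
  exact h4

theorem block_conjTranspose {n : ℕ} (g : symplecticGroup (Fin n) ℝ) :
    (blockA g)ᴴ = (blockA g)ᵀ ∧ (blockB g)ᴴ = (blockB g)ᵀ ∧
    (blockC g)ᴴ = (blockC g)ᵀ ∧ (blockD g)ᴴ = (blockD g)ᵀ := by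
  refine ⟨?_, ?_, ?_, ?_⟩ <;> ext i j <;>
    simp [blockA, blockB, blockC, blockD, Matrix.conjTranspose_apply]

/-- The matrix `CZ + D`. -/
def denomMatrix {n : ℕ} (g : symplecticGroup (Fin n) ℝ) (Z : SiegelSpace n) :
    Matrix (Fin n) (Fin n) ℂ := blockC g * Z + blockD g

/-- The matrix `AZ + B`. -/
def numMatrix {n : ℕ} (g : symplecticGroup (Fin n) ℝ) (Z : SiegelSpace n) :
    Matrix (Fin n) (Fin n) ℂ := blockA g * Z + blockB g

theorem sub_conjTranspose_eq {n : ℕ} {Z : Matrix (Fin n) (Fin n) ℂ} (hZ : Zᵀ = Z) :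
    Z - Zᴴ = (2 * Complex.I) • (Z.map Complex.im).map ((↑) : ℝ → ℂ) := by
  ext i j
  have h : Z j i = Z i j := congrFun (congrFun hZ i) j
  simp only [Matrix.sub_apply, Matrix.conjTranspose_apply, h, Matrix.smul_apply, Matrix.map_apply,
    smul_eq_mul]
  apply Complex.ext <;> simp
  ring

theorem denom_num_transpose {n : ℕ} (g : symplecticGroup (Fin n) ℝ) (Z : SiegelSpace n) :
    (denomMatrix g Z)ᵀ * numMatrix g Z = (numMatrix g Z)ᵀ * denomMatrix g Z := by
  obtain ⟨h1, h2, h3, h4⟩ := block_relations g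
  have hZ := Z.2.1
  rw [← sub_eq_zero]
  simp only [denomMatrix, numMatrix, Matrix.transpose_add, Matrix.transpose_mul, hZ]
  have e : ∀ (W A B C D A' B' C' D' : Matrix (Fin n) (Fin n) ℂ),
      (W * C' + D') * (A * W + B) - (W * A' + B') * (C * W + D)
      = W * (C' * A - A' * C) * W - W * (A' * D - C' * B) + (D' * A - B' * C) * W
        + (D' * B - B' * D) := by
    intros; noncomm_ring
  rw [e, h1, h2, h3, h4]
  simp

theorem denom_num_conjTranspose {n : ℕ} (g : symplecticGroup (Fin n) ℝ) (Z : SiegelSpace n) :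
    (denomMatrix g Z)ᴴ * numMatrix g Z - (numMatrix g Z)ᴴ * denomMatrix g Z
      = (Z : Matrix (Fin n) (Fin n) ℂ) - (Z : Matrix (Fin n) (Fin n) ℂ)ᴴ := by
  obtain ⟨h1, h2, h3, h4⟩ := block_relations g
  obtain ⟨k1, k2, k3, k4⟩ := block_conjTranspose g
  simp only [denomMatrix, numMatrix, Matrix.conjTranspose_add, Matrix.conjTranspose_mul,
    k1, k2, k3, k4]
  have e : ∀ (W V A B C D A' B' C' D' : Matrix (Fin n) (Fin n) ℂ),
      (V * C' + D') * (A * W + B) - (V * A' + B') * (C * W + D)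
      = V * (C' * A - A' * C) * W - V * (A' * D - C' * B) + (D' * A - B' * C) * W
        + (D' * B - B' * D) := by
    intros; noncomm_ring
  rw [e, h1, h2, h3, h4]
  simp
  abel

theorem isUnit_denomMatrix {n : ℕ} (g : symplecticGroup (Fin n) ℝ) (Z : SiegelSpace n) :
    IsUnit (denomMatrix g Z) := by
  open scoped ComplexOrder in
  rw [← Matrix.mulVec_injective_iff_isUnit]
  rw [← Matrix.coe_mulVecLin, injective_iff_map_eq_zero]
  intro v hv
  by_contra hv0
  have hv' : denomMatrix g Z *ᵥ v = 0 := hv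
  have hpos := (posDef_map_ofReal_iff.2 (imPart_posDef Z)).dotProduct_mulVec_pos hv0
  have key := congrArg (fun M => star v ⬝ᵥ (M *ᵥ v)) (denom_num_conjTranspose g Z)
  simp only [sub_conjTranspose_eq Z.2.1, Matrix.sub_mulVec, ← Matrix.mulVec_mulVec, hv',
    Matrix.mulVec_zero, sub_zero, Matrix.smul_mulVec, dotProduct_smul] at key
  rw [Matrix.dotProduct_mulVec, ← Matrix.star_mulVec, hv', star_zero, zero_dotProduct] at key
  have := (smul_eq_zero.1 key.symm).resolve_left (by simp)
  exact hpos.ne' this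

/-- The factor of automorphy `J(g, Z) = CZ + D`, an element of `GL_n(ℂ)`. -/
noncomputable def autFactor {n : ℕ} (g : symplecticGroup (Fin n) ℝ) (Z : SiegelSpace n) :
    GL (Fin n) ℂ := (isUnit_denomMatrix g Z).unit

theorem moebius_mem {n : ℕ} (g : symplecticGroup (Fin n) ℝ) (Z : SiegelSpace n) :
    numMatrix g Z * (denomMatrix g Z)⁻¹ ∈ siegelSet n := by
  open scoped ComplexOrder in
  have hu := isUnit_denomMatrix g Z
  have hd := (Matrix.isUnit_iff_isUnit_det _).1 hu
  have hdT : IsUnit (denomMatrix g Z)ᵀ.det := by rwa [Matrix.det_transpose]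
  have hdH : IsUnit (denomMatrix g Z)ᴴ.det := by rw [Matrix.det_conjTranspose]; exact hd.star
  have hsym : (numMatrix g Z * (denomMatrix g Z)⁻¹)ᵀ = numMatrix g Z * (denomMatrix g Z)⁻¹ := by
    rw [Matrix.transpose_mul, Matrix.transpose_nonsing_inv]
    have h := denom_num_transpose g Z
    calc (denomMatrix g Z)ᵀ⁻¹ * (numMatrix g Z)ᵀ
        = (denomMatrix g Z)ᵀ⁻¹ * ((numMatrix g Z)ᵀ * denomMatrix g Z) * (denomMatrix g Z)⁻¹ := by
          rw [Matrix.mul_assoc, Matrix.mul_assoc, Matrix.mul_nonsing_inv _ hd, Matrix.mul_one]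
      _ = numMatrix g Z * (denomMatrix g Z)⁻¹ := by
          rw [← h, ← Matrix.mul_assoc, Matrix.nonsing_inv_mul _ hdT, Matrix.one_mul]
  refine ⟨hsym, posDef_map_ofReal_iff.1 ?_⟩
  have h2I : (2 * Complex.I) ≠ 0 := by simp
  have e : ((numMatrix g Z * (denomMatrix g Z)⁻¹).map Complex.im).map ((↑) : ℝ → ℂ)
      = ((denomMatrix g Z)⁻¹)ᴴ * (imPart Z).map ((↑) : ℝ → ℂ) * (denomMatrix g Z)⁻¹ := by
    apply smul_right_injective _ h2I
    simp only
    rw [← sub_conjTranspose_eq hsym, ← Matrix.smul_mul, ← Matrix.mul_smul]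
    rw [show (2 * Complex.I) • (imPart Z).map ((↑) : ℝ → ℂ) = _ from
      (sub_conjTranspose_eq Z.2.1).symm, ← denom_num_conjTranspose g Z]
    rw [Matrix.conjTranspose_mul, Matrix.conjTranspose_nonsing_inv, Matrix.mul_sub, Matrix.sub_mul,
      ← Matrix.mul_assoc, Matrix.nonsing_inv_mul _ hdH, Matrix.one_mul,
      Matrix.mul_assoc, Matrix.mul_assoc, Matrix.mul_nonsing_inv _ hd, Matrix.mul_one]
  rw [e]
  exact (posDef_map_ofReal_iff.2 (imPart_posDef Z)).conjTranspose_mul_mul_same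
    (Matrix.mulVec_injective_iff_isUnit.2
      ((Matrix.isUnit_iff_isUnit_det _).2 (by simpa using hd)))

/-- The action `gZ = (AZ + B)(CZ + D)⁻¹` of `Sp_{2n}(ℝ)` on `ℍ_n`. -/
noncomputable def moebius {n : ℕ} (g : symplecticGroup (Fin n) ℝ) (Z : SiegelSpace n) :
    SiegelSpace n := ⟨numMatrix g Z * (denomMatrix g Z)⁻¹, moebius_mem g Z⟩

/-! ### Nearly holomorphic functions and Fourier expansions -/

/-- The index set `{(i, j) : i ≤ j}`. -/
abbrev UpperIndex (n : ℕ) : Type := {q : Fin n × Fin n // q.1 ≤ q.2}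

/-- The exponents `(b_{ij})_{i ≤ j}` of nonnegative integers with `∑ b_{ij} ≤ p`. -/
def exponents (n p : ℕ) : Finset (UpperIndex n → ℕ) :=
  (Fintype.piFinset fun _ => Finset.range (p + 1)).filter fun b => ∑ q, b q ≤ p

theorem mem_exponents {n p : ℕ} {b : UpperIndex n → ℕ} :
    b ∈ exponents n p ↔ ∑ q, b q ≤ p := by
  simp only [exponents, Finset.mem_filter, Fintype.mem_piFinset, Finset.mem_range,
    and_iff_right_iff_imp]
  intro h q
  exact Nat.lt_succ_of_le ((Finset.single_le_sum (fun _ _ => Nat.zero_le _)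
    (Finset.mem_univ q)).trans h)

/-- The monomial `[V]^b = ∏_{i ≤ j} v_{ij}^{b_{ij}}`. -/
def entryMonomial {n : ℕ} (V : Matrix (Fin n) (Fin n) ℝ) (b : UpperIndex n → ℕ) : ℝ :=
  ∏ q : UpperIndex n, V q.1.1 q.1.2 ^ b q

/-- `f ∈ N^p(ℍ_n)`: `f` is a polynomial of total degree at most `p` in the entries of `Y⁻¹`, with
holomorphic functions on `ℍ_n` as coefficients. Holomorphy on `ℍ_n`, which is open in the space of
symmetric complex matrices, is complex differentiability along the set `ℍ_n`. -/
def IsNearlyHolomorphic {n : ℕ} (p : ℕ) (f : SiegelSpace n → ℂ) : Prop :=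
  ∃ G : (UpperIndex n → ℕ) → Matrix (Fin n) (Fin n) ℂ → ℂ,
    (∀ b, DifferentiableOn ℂ (G b) (siegelSet n)) ∧
    ∀ Z : SiegelSpace n,
      f Z = ∑ b ∈ exponents n p, G b Z * (entryMonomial (imPart Z)⁻¹ b : ℂ)

/-- The positive semidefinite matrices in `(1/N) M_n^sym(ℤ)`. -/
def fourierIndex (n N : ℕ) : Set (Matrix (Fin n) (Fin n) ℝ) :=
  {S | (∃ T : Matrix (Fin n) (Fin n) ℤ, Tᵀ = T ∧ S = (1 / (N : ℝ)) • T.map ((↑) : ℤ → ℝ)) ∧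
    S.PosSemidef}

/-- The function `e^{2πi Tr(SZ)}`. -/
noncomputable def fourierExp {n : ℕ} (S : Matrix (Fin n) (Fin n) ℝ) (Z : SiegelSpace n) : ℂ :=
  Complex.exp (2 * Real.pi * Complex.I *
    (S.map ((↑) : ℝ → ℂ) * (Z : Matrix (Fin n) (Fin n) ℂ)).trace)

/-- A function in `N^p(ℍ_n)` has a nice Fourier expansion if, for some positive integer `N`,
`f(Z) = ∑_b ∑_S a_b(S) e^{2πi Tr(SZ)} [Y⁻¹]^b`, with `S` running over the positive semidefinite
matrices in `(1/N) M_n^sym(ℤ)` and absolute and uniform convergence on compact subsets. -/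
def HasNiceFourierExpansion {n : ℕ} (p : ℕ) (f : SiegelSpace n → ℂ) : Prop :=
  ∃ N : ℕ, 0 < N ∧ ∃ a : (UpperIndex n → ℕ) → Matrix (Fin n) (Fin n) ℝ → ℂ,
    let term : (exponents n p × fourierIndex n N) → SiegelSpace n → ℂ := fun q Z =>
      a q.1 q.2 * fourierExp (q.2 : Matrix (Fin n) (Fin n) ℝ) Z *
        (entryMonomial (imPart Z)⁻¹ (q.1 : UpperIndex n → ℕ) : ℂ)
    (∀ Z, Summable fun q => ‖term q Z‖) ∧
    ∀ K : Set (SiegelSpace n), IsCompact K → HasSumUniformlyOn term f K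

/-! ### Congruence subgroups -/

/-- The homomorphism of symplectic groups induced by a ring homomorphism. -/
def symplecticMap (n : ℕ) {R S : Type*} [CommRing R] [CommRing S] (φ : R →+* S) :
    symplecticGroup (Fin n) R →* symplecticGroup (Fin n) S where
  toFun g := ⟨(g : Matrix (Fin n ⊕ Fin n) (Fin n ⊕ Fin n) R).map φ,
    SymplecticGroup.map_mem g.2 φ⟩
  map_one' := Subtype.ext (by simp)
  map_mul' g h := Subtype.ext (by simp)

/-- `Sp_{2n}(ℤ)` as a subgroup of `Sp_{2n}(ℚ)`. -/
def integralSymplectic (n : ℕ) : Subgroup (symplecticGroup (Fin n) ℚ) :=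
  (symplecticMap n (Int.castRingHom ℚ)).range

/-- The principal congruence subgroup of level `N`, the kernel of reduction modulo `N` on
`Sp_{2n}(ℤ)`, as a subgroup of `Sp_{2n}(ℚ)`. -/
def principalCongruence (n N : ℕ) : Subgroup (symplecticGroup (Fin n) ℚ) :=
  (symplecticMap n (Int.castRingHom (ZMod N))).ker.map (symplecticMap n (Int.castRingHom ℚ))

/-- Congruence subgroups of `Sp_{2n}(ℚ)`. -/
def IsCongruenceSubgroup {n : ℕ} (Γ : Subgroup (symplecticGroup (Fin n) ℚ)) : Prop :=
  Γ.Commensurable (integralSymplectic n) ∧ ∃ N : ℕ, 0 < N ∧ principalCongruence n N ≤ Γ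

/-! ### Rational representations of `GL_n(ℂ)` -/

section Rep

variable {n : ℕ} {V : Type*} [AddCommGroup V] [Module ℂ V]

/-- A representation of `GL_n(ℂ)` is rational if its matrix coefficients are regular functions on
`GL_n(ℂ)`, i.e. polynomials in the matrix entries divided by powers of the determinant. -/
def IsRational (ρ : Representation ℂ (GL (Fin n) ℂ) V) : Prop :=
  ∀ (v : V) (l : Module.Dual ℂ V), ∃ (P : MvPolynomial (Fin n × Fin n) ℂ) (k : ℕ),
    ∀ g : GL (Fin n) ℂ,
      l (ρ g v) = MvPolynomial.eval (fun q => (g : Matrix (Fin n) (Fin n) ℂ) q.1 q.2) P /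
        (g : Matrix (Fin n) (Fin n) ℂ).det ^ k

/-- `lam` is the highest weight of `ρ`: some nonzero vector is an eigenvector of the group of
upper triangular matrices, with character `b ↦ ∏_i b_{ii}^{lam_i}`. -/
def IsHighestWeight (ρ : Representation ℂ (GL (Fin n) ℂ) V) (lam : Fin n → ℤ) : Prop :=
  ∃ v : V, v ≠ 0 ∧ ∀ g : GL (Fin n) ℂ, (g : Matrix (Fin n) (Fin n) ℂ).BlockTriangular id →
    ρ g v = (∏ i, (g : Matrix (Fin n) (Fin n) ℂ) i i ^ lam i) • v

/-- The slash operator `(F|_ρ g)(Z) = ρ(J(g, Z))⁻¹ F(gZ)`. -/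
noncomputable def slash (ρ : Representation ℂ (GL (Fin n) ℂ) V) (F : SiegelSpace n → V)
    (g : symplecticGroup (Fin n) ℝ) (Z : SiegelSpace n) : V :=
  ρ (autFactor g Z)⁻¹ (F (moebius g Z))

/-- `Sp_{2n}(ℚ)` inside `Sp_{2n}(ℝ)`. -/
noncomputable def ratToReal (n : ℕ) : symplecticGroup (Fin n) ℚ →* symplecticGroup (Fin n) ℝ :=
  symplecticMap n (Rat.castHom ℝ)

/-- The space `N^p_ρ(Γ)`. -/
structure IsNearlyHolomorphicForm (ρ : Representation ℂ (GL (Fin n) ℂ) V) (p : ℕ)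
    (Γ : Subgroup (symplecticGroup (Fin n) ℚ)) (F : SiegelSpace n → V) : Prop where
  nearlyHolomorphic : ∀ (g : symplecticGroup (Fin n) ℚ) (l : Module.Dual ℂ V),
    IsNearlyHolomorphic p fun Z => l (slash ρ F (ratToReal n g) Z)
  fourier : ∀ (g : symplecticGroup (Fin n) ℚ) (l : Module.Dual ℂ V),
    HasNiceFourierExpansion p fun Z => l (slash ρ F (ratToReal n g) Z)
  invariant : ∀ γ ∈ Γ, slash ρ F (ratToReal n γ) = F

/-- The space `N_ρ^{(n)}` of nearly holomorphic Siegel modular forms of weight `ρ`, with respect to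
some congruence subgroup. -/
def nearlyHolomorphicForms (ρ : Representation ℂ (GL (Fin n) ℂ) V) : Set (SiegelSpace n → V) :=
  {F | ∃ Γ : Subgroup (symplecticGroup (Fin n) ℚ), IsCongruenceSubgroup Γ ∧
    ∃ p : ℕ, IsNearlyHolomorphicForm ρ p Γ F}

end Rep

end SiegelModular

/-!
Reduction theory for symplectic frames yields, for each `Z`, some `γ ∈ Sp_{2n}(ℤ)` with
`Tr Im(γZ)⁻¹` bounded in terms of `n` only. Put `h = Y^{1/2} J(γ, Z)⁻¹`. Then `hᴴ h = Im(γZ)`, so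
the entries of `h⁻¹` are bounded, and `ρ(Y^{1/2}) F(Z) = ρ(h) (F|γ⁻¹)(γZ)`.

There are only finitely many translates `F|γ⁻¹`, and each is bounded on `{Tr Y⁻¹ ≤ C}` because its
Fourier expansion is dominated term by term by the one at a suitable fixed point. For `h⁻¹` with
bounded entries, `ρ(h)` is at most a constant times `|det h|^{λ₁}`: by irreducibility this need only
be checked on a highest weight vector, where it follows from the QR decomposition. Finally
`|det h| = (det Y)^{1/2} / |det J(γ, Z)|`, and `|det J(γ, Z)|` is at least a constant times
`∏ min(μᵢ, 1)`: when `Y` is diagonalised, `det J(γ, ·)` is affine in each diagonal entry and has no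
zeros in the upper half plane, so a Harnack inequality applies one variable at a time.
-/

namespace SiegelModular

/-! ### The cocycle relation and the imaginary part of `gZ` -/

section MapOfReal

variable {l m k : Type*} [Fintype m]

theorem map_ofReal_mul (A : Matrix l m ℝ) (B : Matrix m k ℝ) :
    (A * B).map ((↑) : ℝ → ℂ) = A.map ((↑) : ℝ → ℂ) * B.map ((↑) : ℝ → ℂ) :=
  Matrix.map_mul (f := Complex.ofRealHom)

theorem map_ofReal_inv [DecidableEq m] {A : Matrix m m ℝ} (hA : IsUnit A) :
    A⁻¹.map ((↑) : ℝ → ℂ) = (A.map ((↑) : ℝ → ℂ))⁻¹ := by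
  refine (Matrix.inv_eq_left_inv ?_).symm
  rw [← map_ofReal_mul, Matrix.nonsing_inv_mul _ ((Matrix.isUnit_iff_isUnit_det _).1 hA)]
  exact map_one Complex.ofRealHom.mapMatrix

theorem conjTranspose_map_ofReal (A : Matrix l k ℝ) :
    (A.map ((↑) : ℝ → ℂ))ᴴ = Aᵀ.map ((↑) : ℝ → ℂ) := by
  ext i j
  simp

theorem re_trace_map_ofReal (A : Matrix m m ℝ) :
    (A.map ((↑) : ℝ → ℂ)).trace.re = A.trace := by
  simp [Matrix.trace]

end MapOfReal

open scoped MatrixOrder in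
theorem conjTranspose_posDefSqrt {n : ℕ} {Y : Matrix (Fin n) (Fin n) ℝ} (hY : Y.PosDef) :
    (posDefSqrt Y hY : Matrix (Fin n) (Fin n) ℂ)ᴴ = posDefSqrt Y hY :=
  (conjTranspose_map_ofReal _).trans
    (congrArg (fun A : Matrix (Fin n) (Fin n) ℝ => A.map _) (CFC.sqrt_nonneg Y).posSemidef.1)

open scoped MatrixOrder in
theorem posDefSqrt_mul_self {n : ℕ} {Y : Matrix (Fin n) (Fin n) ℝ} (hY : Y.PosDef) :
    (posDefSqrt Y hY : Matrix (Fin n) (Fin n) ℂ) * posDefSqrt Y hY = Y.map ((↑) : ℝ → ℂ) :=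
  (map_ofReal_mul _ _).symm.trans
    (congrArg (fun A : Matrix (Fin n) (Fin n) ℝ => A.map _)
      (CFC.sqrt_mul_sqrt_self Y hY.posSemidef.nonneg))

section Action

variable {n : ℕ}

theorem blocks_mul (g h : symplecticGroup (Fin n) ℝ) :
    blockA (g * h) = blockA g * blockA h + blockB g * blockC h ∧
    blockB (g * h) = blockA g * blockB h + blockB g * blockD h ∧
    blockC (g * h) = blockC g * blockA h + blockD g * blockC h ∧
    blockD (g * h) = blockC g * blockB h + blockD g * blockD h := by
  refine ⟨?_, ?_, ?_, ?_⟩ <;> ext i j <;>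
    simp [blockA, blockB, blockC, blockD, toBlocks₁₁, toBlocks₁₂, toBlocks₂₁, toBlocks₂₂,
      Matrix.mul_apply, Fintype.sum_sum_type]

theorem isUnit_det_denomMatrix (g : symplecticGroup (Fin n) ℝ) (Z : SiegelSpace n) :
    IsUnit (denomMatrix g Z).det :=
  (Matrix.isUnit_iff_isUnit_det _).1 (isUnit_denomMatrix g Z)

theorem coe_moebius_mul_denomMatrix (g : symplecticGroup (Fin n) ℝ) (Z : SiegelSpace n) :
    (moebius g Z : Matrix (Fin n) (Fin n) ℂ) * denomMatrix g Z = numMatrix g Z :=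
  Matrix.nonsing_inv_mul_cancel_right _ _ (isUnit_det_denomMatrix g Z)

theorem denomMatrix_mul (g h : symplecticGroup (Fin n) ℝ) (Z : SiegelSpace n) :
    denomMatrix (g * h) Z = denomMatrix g (moebius h Z) * denomMatrix h Z := by
  obtain ⟨-, -, hC, hD⟩ := blocks_mul g h
  rw [denomMatrix.eq_1 g, add_mul, mul_assoc, coe_moebius_mul_denomMatrix, denomMatrix, hC, hD,
    numMatrix, denomMatrix]
  noncomm_ring

theorem numMatrix_mul (g h : symplecticGroup (Fin n) ℝ) (Z : SiegelSpace n) :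
    numMatrix (g * h) Z = numMatrix g (moebius h Z) * denomMatrix h Z := by
  obtain ⟨hA, hB, -, -⟩ := blocks_mul g h
  rw [numMatrix.eq_1 g, add_mul, mul_assoc, coe_moebius_mul_denomMatrix, numMatrix, hA, hB,
    numMatrix, denomMatrix]
  noncomm_ring

theorem moebius_mul (g h : symplecticGroup (Fin n) ℝ) (Z : SiegelSpace n) :
    moebius (g * h) Z = moebius g (moebius h Z) := by
  refine Subtype.ext ?_
  change numMatrix (g * h) Z * (denomMatrix (g * h) Z)⁻¹ =
    numMatrix g (moebius h Z) * (denomMatrix g (moebius h Z))⁻¹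
  rw [numMatrix_mul, denomMatrix_mul, Matrix.mul_inv_rev, ← mul_assoc,
    Matrix.mul_nonsing_inv_cancel_right _ _ (isUnit_det_denomMatrix h Z)]

theorem autFactor_mul (g h : symplecticGroup (Fin n) ℝ) (Z : SiegelSpace n) :
    autFactor (g * h) Z = autFactor g (moebius h Z) * autFactor h Z :=
  Units.ext (denomMatrix_mul g h Z)

theorem slash_mul {V : Type*} [AddCommGroup V] [Module ℂ V]
    (ρ : Representation ℂ (GL (Fin n) ℂ) V) (F : SiegelSpace n → V)
    (g h : symplecticGroup (Fin n) ℝ) : slash ρ F (g * h) = slash ρ (slash ρ F g) h := by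
  funext Z
  rw [slash, slash, slash, moebius_mul, autFactor_mul, _root_.mul_inv_rev, map_mul,
    Module.End.mul_apply]

theorem imPart_moebius (g : symplecticGroup (Fin n) ℝ) (Z : SiegelSpace n) :
    (imPart (moebius g Z)).map ((↑) : ℝ → ℂ) =
      ((denomMatrix g Z)⁻¹)ᴴ * (imPart Z).map ((↑) : ℝ → ℂ) * (denomMatrix g Z)⁻¹ := by
  have hJ := isUnit_det_denomMatrix g Z
  have hJH : IsUnit (denomMatrix g Z)ᴴ.det := by
    rw [Matrix.det_conjTranspose]
    exact hJ.star
  have h2I : 2 * Complex.I ≠ 0 := by simp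
  refine smul_right_injective _ h2I ?_
  calc (2 * Complex.I) • (imPart (moebius g Z)).map ((↑) : ℝ → ℂ)
      = numMatrix g Z * (denomMatrix g Z)⁻¹ - (numMatrix g Z * (denomMatrix g Z)⁻¹)ᴴ :=
        (sub_conjTranspose_eq (moebius g Z).2.1).symm
    _ = ((denomMatrix g Z)⁻¹)ᴴ * ((denomMatrix g Z)ᴴ * numMatrix g Z -
          (numMatrix g Z)ᴴ * denomMatrix g Z) * (denomMatrix g Z)⁻¹ := by
        rw [Matrix.conjTranspose_mul, Matrix.conjTranspose_nonsing_inv, Matrix.mul_sub,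
          Matrix.sub_mul, Matrix.nonsing_inv_mul_cancel_left _ _ hJH, Matrix.mul_assoc,
          Matrix.mul_assoc, Matrix.mul_nonsing_inv _ hJ, Matrix.mul_one]
    _ = ((denomMatrix g Z)⁻¹)ᴴ * ((2 * Complex.I) • (imPart Z).map ((↑) : ℝ → ℂ)) *
          (denomMatrix g Z)⁻¹ := by
        rw [denom_num_conjTranspose, sub_conjTranspose_eq Z.2.1]
        rfl
    _ = _ := by rw [Matrix.mul_smul, Matrix.smul_mul]

/-- The matrix `Y^{1/2} (CZ + D)⁻¹`, a square root of `Im(gZ)`. It intertwines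
`ρ(Y^{1/2}) F(Z)` with the value of a translate of `F` at `gZ`. -/
noncomputable def sqrtFactor (g : symplecticGroup (Fin n) ℝ) (Z : SiegelSpace n) :
    GL (Fin n) ℂ :=
  posDefSqrt (imPart Z) (imPart_posDef Z) * (autFactor g Z)⁻¹

theorem coe_inv_sqrtFactor (g : symplecticGroup (Fin n) ℝ) (Z : SiegelSpace n) :
    (sqrtFactor g Z)⁻¹.val =
      denomMatrix g Z * (posDefSqrt (imPart Z) (imPart_posDef Z))⁻¹.val := by
  rw [sqrtFactor, _root_.mul_inv_rev, inv_inv]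
  rfl

theorem conjTranspose_sqrtFactor_mul_self (g : symplecticGroup (Fin n) ℝ) (Z : SiegelSpace n) :
    (sqrtFactor g Z).valᴴ * (sqrtFactor g Z).val =
      (imPart (moebius g Z)).map ((↑) : ℝ → ℂ) := by
  have hJ : (autFactor g Z)⁻¹.val = (denomMatrix g Z)⁻¹ :=
    Matrix.coe_units_inv _
  rw [imPart_moebius, sqrtFactor, Units.val_mul, conjTranspose_mul, conjTranspose_posDefSqrt, hJ,
    ← posDefSqrt_mul_self (imPart_posDef Z)]
  noncomm_ring

theorem inv_sqrtFactor_mul_conjTranspose (g : symplecticGroup (Fin n) ℝ) (Z : SiegelSpace n) :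
    (sqrtFactor g Z)⁻¹.val * (sqrtFactor g Z)⁻¹.valᴴ =
      (imPart (moebius g Z))⁻¹.map ((↑) : ℝ → ℂ) := by
  rw [map_ofReal_inv (imPart_posDef _).isUnit, ← conjTranspose_sqrtFactor_mul_self,
    Matrix.mul_inv_rev, ← Matrix.conjTranspose_nonsing_inv, Matrix.coe_units_inv]

theorem slash_eq_sqrtFactor {V : Type*} [AddCommGroup V] [Module ℂ V]
    (ρ : Representation ℂ (GL (Fin n) ℂ) V) (F : SiegelSpace n → V)
    (g : symplecticGroup (Fin n) ℝ) (Z : SiegelSpace n) :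
    ρ (posDefSqrt (imPart Z) (imPart_posDef Z)) (slash ρ F g Z) =
      ρ (sqrtFactor g Z) (F (moebius g Z)) := by
  rw [slash, ← Module.End.mul_apply, ← map_mul, sqrtFactor]

theorem re_trace_mul_conjTranspose {m k : Type*} [Fintype m] [Fintype k] (A : Matrix m k ℂ) :
    (A * Aᴴ).trace.re = ∑ i, ∑ j, ‖A i j‖ ^ 2 := by
  simp only [Matrix.trace, Matrix.diag_apply, Matrix.mul_apply, conjTranspose_apply,
    Complex.star_def, Complex.mul_conj, Complex.normSq_eq_norm_sq, Complex.re_sum,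
    Complex.ofReal_re]

theorem norm_apply_sq_le_re_trace {m k : Type*} [Fintype m] [Fintype k] (A : Matrix m k ℂ)
    (i : m) (j : k) : ‖A i j‖ ^ 2 ≤ (A * Aᴴ).trace.re := by
  rw [re_trace_mul_conjTranspose]
  exact (Finset.single_le_sum (f := fun j => ‖A i j‖ ^ 2) (fun _ _ => sq_nonneg _)
    (Finset.mem_univ j)).trans (Finset.single_le_sum (f := fun i => ∑ j, ‖A i j‖ ^ 2)
      (fun _ _ => Finset.sum_nonneg fun _ _ => sq_nonneg _) (Finset.mem_univ i))

theorem norm_inv_sqrtFactor_apply_le {g : symplecticGroup (Fin n) ℝ} {Z : SiegelSpace n} {R : ℝ}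
    (hR : (imPart (moebius g Z))⁻¹.trace ≤ R) (i j : Fin n) :
    ‖(sqrtFactor g Z)⁻¹.val i j‖ ≤ √R := by
  refine Real.le_sqrt_of_sq_le ((norm_apply_sq_le_re_trace _ i j).trans ?_)
  rwa [inv_sqrtFactor_mul_conjTranspose, re_trace_map_ofReal]

end Action

/-! ### Reduction of symplectic frames -/

section Frames

variable {E : Type*} [NormedAddCommGroup E] [InnerProductSpace ℂ E] {ι κ : Type*}

/-- The real symplectic form on a complex inner product space given by the imaginary part of the
inner product. -/
noncomputable def imInner : LinearMap.BilinForm ℝ E :=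
  LinearMap.mk₂ ℝ (fun x y => (inner ℂ x y).im)
    (fun x y z => by rw [inner_add_left, Complex.add_im])
    (fun c x y => by rw [inner_smul_left_eq_smul, Complex.smul_im])
    (fun x y z => by rw [inner_add_right, Complex.add_im])
    (fun c x y => by rw [inner_smul_right_eq_smul, Complex.smul_im])

theorem imInner_apply (x y : E) : imInner x y = (inner ℂ x y).im := rfl

theorem isAlt_imInner : (imInner (E := E)).IsAlt := fun x => inner_self_im (𝕜 := ℂ) x

theorem neg_imInner (x y : E) : -imInner x y = imInner y x := isAlt_imInner.neg_eq x y

/-- Two families of vectors that pair like the two halves of a symplectic basis. -/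
structure IsSymplecticFrame [DecidableEq ι] (e f : ι → E) : Prop where
  left : ∀ i j, imInner (e i) (e j) = 0
  right : ∀ i j, imInner (f i) (f j) = 0
  pair : ∀ i j, imInner (e i) (f j) = if i = j then 1 else 0

/-- The lattice generated by the vectors of a frame. -/
def frameLattice {M : Type*} [AddCommGroup M] (e f : ι → M) : Submodule ℤ M :=
  Submodule.span ℤ (Set.range e ∪ Set.range f)

theorem frameLattice_le_iff {M : Type*} [AddCommGroup M] {e f : ι → M} {L : Submodule ℤ M} :
    frameLattice e f ≤ L ↔ (∀ i, e i ∈ L) ∧ ∀ i, f i ∈ L := by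
  simp only [frameLattice, Submodule.span_le, Set.union_subset_iff, Set.range_subset_iff,
    SetLike.mem_coe]

theorem map_frameLattice {M N : Type*} [AddCommGroup M] [AddCommGroup N] (L : M →ₗ[ℤ] N)
    (e f : ι → M) : (frameLattice e f).map L = frameLattice (L ∘ e) (L ∘ f) := by
  rw [frameLattice, Submodule.map_span, Set.image_union, ← Set.range_comp, ← Set.range_comp,
    frameLattice]

theorem imInner_eq_zero_of_mem_frameLattice {e f : ι → E} {x y : E}
    (he : ∀ i, imInner x (e i) = 0) (hf : ∀ i, imInner x (f i) = 0)
    (hy : y ∈ frameLattice e f) : imInner x y = 0 :=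
  (frameLattice_le_iff (L := (imInner x).ker.restrictScalars ℤ)).2 ⟨he, hf⟩ hy

namespace IsSymplecticFrame

variable [DecidableEq ι] {e f : ι → E}

theorem comp [DecidableEq κ] (h : IsSymplecticFrame e f) {s : κ → ι}
    (hs : Function.Injective s) : IsSymplecticFrame (e ∘ s) (f ∘ s) where
  left i j := h.left _ _
  right i j := h.right _ _
  pair i j := by simp [h.pair, hs.eq_iff]

theorem ne_zero (h : IsSymplecticFrame e f) (i : ι) : e i ≠ 0 := by
  intro h0
  simpa [h0] using h.pair i i

theorem add_zsmul_neg (h : IsSymplecticFrame e f) (k : ℤ) :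
    IsSymplecticFrame (fun i => f i + k • e i) (fun i => -e i) where
  left i j := by
    simp [h.left, h.right, h.pair, ← neg_imInner (e j) (f i), eq_comm]
  right i j := by simp [h.left]
  pair i j := by simp [h.left, ← neg_imInner (e j) (f i), h.pair, eq_comm]

theorem cons {n : ℕ} {u v : Fin n → E} (h : IsSymplecticFrame u v) {p q : E}
    (hpq : imInner p q = 1) (hpu : ∀ i, imInner p (u i) = 0) (hpv : ∀ i, imInner p (v i) = 0)
    (hqu : ∀ i, imInner q (u i) = 0) (hqv : ∀ i, imInner q (v i) = 0) (k : Fin n → ℤ) :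
    IsSymplecticFrame (Fin.cons p fun i => u i + k i • p : Fin (n + 1) → E)
      (Fin.cons (q - ∑ j, k j • v j) v) := by
  have hup : ∀ i, imInner (u i) p = 0 := fun i => by rw [← neg_imInner, hpu, neg_zero]
  have huq : ∀ i, imInner (u i) q = 0 := fun i => by rw [← neg_imInner, hqu, neg_zero]
  have hvq : ∀ i, imInner (v i) q = 0 := fun i => by rw [← neg_imInner, hqv, neg_zero]
  refine ⟨fun i j => ?_, fun i j => ?_, fun i j => ?_⟩ <;>
    refine Fin.cases ?_ (fun i => ?_) i <;> refine Fin.cases ?_ (fun j => ?_) j <;>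
    simp [isAlt_imInner p, isAlt_imInner q, hpq, hpu, hpv, hqv, hup, huq, hvq, h.left, h.right,
      h.pair, (Fin.succ_ne_zero _).symm]

/-- The slack `1` makes it unnecessary to show that the infimum of `‖a 0‖ ^ 2` is attained. -/
theorem exists_almost_minimal {n : ℕ} {e f : Fin (n + 1) → E} (h : IsSymplecticFrame e f) :
    ∃ a b : Fin (n + 1) → E, IsSymplecticFrame a b ∧ frameLattice a b ≤ frameLattice e f ∧
      ∀ a' b' : Fin (n + 1) → E, IsSymplecticFrame a' b' →
        frameLattice a' b' ≤ frameLattice a b → ‖a 0‖ ^ 2 ≤ ‖a' 0‖ ^ 2 + 1 := by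
  set S : Set ℝ := {r | ∃ a b : Fin (n + 1) → E, IsSymplecticFrame a b ∧
    frameLattice a b ≤ frameLattice e f ∧ ‖a 0‖ ^ 2 = r}
  have hbdd : BddBelow S := ⟨0, by rintro _ ⟨a, -, -, -, rfl⟩; positivity⟩
  obtain ⟨_, ⟨a, b, hab, hle, rfl⟩, hlt⟩ :=
    exists_lt_of_csInf_lt (s := S) ⟨_, e, f, h, le_rfl, rfl⟩ (lt_add_one (sInf S))
  refine ⟨a, b, hab, hle, fun a' b' hab' hle' => hlt.le.trans ?_⟩
  gcongr
  exact csInf_le hbdd ⟨a', b', hab', hle'.trans hle, rfl⟩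

end IsSymplecticFrame

/-- The orthogonal projection onto the complement of a vector. -/
noncomputable abbrev projPerp (v : E) : E →L[ℂ] (Submodule.span ℂ {v})ᗮ :=
  (Submodule.span ℂ {v})ᗮ.orthogonalProjectionOnto

theorem inner_eq_inner_projPerp (v x y : E) :
    inner ℂ x y = inner ℂ (projPerp v x) (projPerp v y) +
      (starRingEnd ℂ) (inner ℂ v x) * inner ℂ v y / ((‖v‖ ^ 2 : ℝ) : ℂ) := by
  have hperp : inner ℂ (projPerp v x) (projPerp v y)
      = inner ℂ ((Submodule.span ℂ {v})ᗮ.starProjection x) y :=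
    Submodule.inner_orthogonalProjectionOnto_eq_of_mem_left _ _
  conv_lhs =>
    rw [← Submodule.starProjection_add_starProjection_orthogonal (K := Submodule.span ℂ {v}) x]
  rw [hperp, inner_add_left, Submodule.starProjection_singleton, inner_smul_left, map_div₀,
    RCLike.ofReal_eq_complex_ofReal, Complex.conj_ofReal]
  ring

theorem imInner_projPerp {v x y : E} (hx : imInner v x = 0) (hy : imInner v y = 0) :
    imInner (projPerp v x) (projPerp v y) = imInner x y := by
  rw [imInner_apply] at hx hy
  rw [imInner_apply, imInner_apply, inner_eq_inner_projPerp v x y, Complex.add_im,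
    Complex.div_ofReal_im, Complex.mul_im, Complex.conj_im, hx, hy]
  ring

theorem norm_sq_eq_projPerp (v x : E) :
    ‖x‖ ^ 2 = ‖projPerp v x‖ ^ 2 + Complex.normSq (inner ℂ v x) / ‖v‖ ^ 2 := by
  have h := inner_eq_inner_projPerp v x x
  rw [inner_self_eq_norm_sq_to_K, inner_self_eq_norm_sq_to_K,
    ← Complex.normSq_eq_conj_mul_self] at h
  simp only [RCLike.ofReal_eq_complex_ofReal] at h
  exact_mod_cast h

theorem isSymplecticFrame_projPerp_iff [DecidableEq ι] {p : E} {u v : ι → E}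
    (hu : ∀ i, imInner p (u i) = 0) (hv : ∀ i, imInner p (v i) = 0) :
    IsSymplecticFrame (projPerp p ∘ u) (projPerp p ∘ v) ↔ IsSymplecticFrame u v := by
  have huu := fun i j => imInner_projPerp (hu i) (hu j)
  have hvv := fun i j => imInner_projPerp (hv i) (hv j)
  have huv := fun i j => imInner_projPerp (hu i) (hv j)
  exact ⟨fun h => ⟨fun i j => (huu i j).symm.trans (h.left i j),
      fun i j => (hvv i j).symm.trans (h.right i j), fun i j => (huv i j).symm.trans (h.pair i j)⟩,
    fun h => ⟨fun i j => (huu i j).trans (h.left i j), fun i j => (hvv i j).trans (h.right i j),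
      fun i j => (huv i j).trans (h.pair i j)⟩⟩

theorem inner_add_zsmul_self (v x : E) (k : ℤ) :
    inner ℂ v (x + k • v) = inner ℂ v x + ((k * ‖v‖ ^ 2 : ℝ) : ℂ) := by
  rw [inner_add_right, ← Int.cast_smul_eq_zsmul ℂ, inner_smul_right, inner_self_eq_norm_sq_to_K]
  push_cast
  rfl

theorem exists_zsmul_norm_sq_le {v : E} (hv : v ≠ 0) (x : E) : ∃ k : ℤ,
    ‖x + k • v‖ ^ 2 ≤ ‖projPerp v x‖ ^ 2 + ‖v‖ ^ 2 / 4 + imInner v x ^ 2 / ‖v‖ ^ 2 := by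
  have hw : 0 < ‖v‖ ^ 2 := by positivity
  set r := (inner ℂ v x).re / ‖v‖ ^ 2
  have hre : (inner ℂ v x).re = r * ‖v‖ ^ 2 := (div_mul_cancel₀ _ hw.ne').symm
  have hround : (r - round r) ^ 2 ≤ 1 / 4 := by
    rw [← sq_abs]
    nlinarith [abs_nonneg (r - round r), abs_sub_round r]
  refine ⟨-round r, ?_⟩
  have hproj : projPerp v (x + (-round r) • v) = projPerp v x := by
    rw [map_add, map_zsmul,
      Submodule.orthogonalProjectionOnto_orthogonalComplement_singleton_eq_zero, smul_zero,
      add_zero]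
  rw [norm_sq_eq_projPerp v, hproj, inner_add_zsmul_self, add_assoc]
  gcongr
  rw [Complex.normSq_apply, Complex.add_re, Complex.add_im, Complex.ofReal_re, Complex.ofReal_im,
    add_zero, add_div, ← imInner_apply, ← sq, ← sq, hre]
  refine add_le_add ?_ le_rfl
  rw [div_le_iff₀ hw]
  push_cast
  nlinarith [sq_nonneg (‖v‖ ^ 2)]

namespace IsSymplecticFrame

variable {n : ℕ} {e f : Fin (n + 1) → E}

theorem imInner_head_tail (h : IsSymplecticFrame e f) {z : E}
    (hz : z ∈ frameLattice (Fin.tail e) (Fin.tail f)) : imInner (e 0) z = 0 ∧ imInner (f 0) z = 0 :=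
  ⟨imInner_eq_zero_of_mem_frameLattice (fun i => h.left _ _)
      (fun i => (h.pair _ _).trans (if_neg (Fin.succ_ne_zero i).symm)) hz,
    imInner_eq_zero_of_mem_frameLattice
      (fun i => by rw [← neg_imInner, Fin.tail, h.pair, if_neg (Fin.succ_ne_zero i), neg_zero])
      (fun i => h.right _ _) hz⟩

theorem projPerp_tail (h : IsSymplecticFrame e f) :
    IsSymplecticFrame (projPerp (e 0) ∘ Fin.tail e) (projPerp (e 0) ∘ Fin.tail f) := by
  obtain ⟨he, hf⟩ := frameLattice_le_iff.1 (le_refl (frameLattice (Fin.tail e) (Fin.tail f)))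
  exact (isSymplecticFrame_projPerp_iff (fun i => (h.imInner_head_tail (he i)).1)
    fun i => (h.imInner_head_tail (hf i)).1).2 (h.comp (Fin.succ_injective n))

theorem exists_lift (h : IsSymplecticFrame e f) {x y : Fin n → (Submodule.span ℂ {e 0})ᗮ}
    (hxy : IsSymplecticFrame x y)
    (hle : frameLattice x y ≤
      frameLattice (projPerp (e 0) ∘ Fin.tail e) (projPerp (e 0) ∘ Fin.tail f)) :
    ∃ a b : Fin (n + 1) → E, IsSymplecticFrame a b ∧ frameLattice a b ≤ frameLattice e f ∧
      a 0 = e 0 ∧ ∀ i : Fin n, ‖a i.succ‖ ^ 2 ≤ ‖x i‖ ^ 2 + ‖e 0‖ ^ 2 / 4 := by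
  obtain ⟨he, hf⟩ := frameLattice_le_iff.1 (le_refl (frameLattice e f))
  have htail : frameLattice (Fin.tail e) (Fin.tail f) ≤ frameLattice e f :=
    frameLattice_le_iff.2 ⟨fun i => he _, fun i => hf _⟩
  have hlift : frameLattice x y ≤ (frameLattice (Fin.tail e) (Fin.tail f)).map
      ((projPerp (e 0)).toLinearMap.restrictScalars ℤ) := by
    rw [map_frameLattice]
    exact hle
  rw [frameLattice_le_iff] at hlift
  choose u hu hux using hlift.1
  choose v hv hvy using hlift.2
  have huv : IsSymplecticFrame u v := by
    refine (isSymplecticFrame_projPerp_iff (fun i => (h.imInner_head_tail (hu i)).1)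
      fun i => (h.imInner_head_tail (hv i)).1).1 ?_
    rwa [← funext hux, ← funext hvy] at hxy
  choose k hk using fun i => exists_zsmul_norm_sq_le (h.ne_zero 0) (u i)
  refine ⟨_, _, huv.cons ((h.pair 0 0).trans (if_pos rfl))
    (fun i => (h.imInner_head_tail (hu i)).1) (fun i => (h.imInner_head_tail (hv i)).1)
    (fun i => (h.imInner_head_tail (hu i)).2) (fun i => (h.imInner_head_tail (hv i)).2) k,
    frameLattice_le_iff.2 ⟨?_, ?_⟩, rfl, fun i => ?_⟩
  · exact Fin.cases (he 0) fun i => add_mem (htail (hu i)) (zsmul_mem (he 0) _)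
  · exact Fin.cases (sub_mem (hf 0) (sum_mem fun j _ => zsmul_mem (htail (hv j)) _))
      fun i => htail (hv i)
  · have hki := hk i
    rw [(h.imInner_head_tail (hu i)).1, zero_pow two_ne_zero, zero_div, add_zero] at hki
    rwa [← hux i]

/-- The competitor is a lifted frame with its first two vectors exchanged, or, if `n = 0`, the frame
with first vector `f 0 + k • e 0`. -/
theorem norm_sq_head_le (h : IsSymplecticFrame e f)
    (hmin : ∀ a b : Fin (n + 1) → E, IsSymplecticFrame a b →
      frameLattice a b ≤ frameLattice e f → ‖e 0‖ ^ 2 ≤ ‖a 0‖ ^ 2 + 1)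
    [FiniteDimensional ℂ E] (hdim : Module.finrank ℂ (Submodule.span ℂ {e 0})ᗮ = n)
    {x y : Fin n → (Submodule.span ℂ {e 0})ᗮ} (hxy : IsSymplecticFrame x y)
    (hle : frameLattice x y ≤
      frameLattice (projPerp (e 0) ∘ Fin.tail e) (projPerp (e 0) ∘ Fin.tail f)) :
    ‖e 0‖ ^ 2 ≤ 2 * (∑ i, ‖x i‖ ^ 2 + 1) := by
  cases n with
  | zero =>
    obtain ⟨k, hk⟩ := exists_zsmul_norm_sq_le (h.ne_zero 0) (f 0)
    obtain ⟨he, hf⟩ := frameLattice_le_iff.1 (le_refl (frameLattice e f))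
    have hshort := hmin _ _ (h.add_zsmul_neg k) (frameLattice_le_iff.2
      ⟨fun i => add_mem (hf i) (zsmul_mem (he i) k), fun i => neg_mem (he i)⟩)
    have hproj : projPerp (e 0) (f 0) = 0 :=
      haveI := Module.finrank_zero_iff.1 hdim
      Subsingleton.elim _ _
    rw [hproj, norm_zero, h.pair, if_pos rfl] at hk
    rw [Fin.sum_univ_zero]
    by_contra! hlt
    have hinv : (1 : ℝ) ^ 2 / ‖e 0‖ ^ 2 < 1 / 2 := by
      rw [one_pow]
      exact one_div_lt_one_div_of_lt two_pos (by linarith)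
    linarith
  | succ n =>
    obtain ⟨a, b, hab, hsub, -, hlen⟩ := h.exists_lift hxy hle
    have hswap := hmin _ _ (hab.comp (Equiv.swap 0 1).injective) (frameLattice_le_iff.2
      ⟨fun i => (frameLattice_le_iff.1 hsub).1 _, fun i => (frameLattice_le_iff.1 hsub).2 _⟩)
    rw [Function.comp_apply, Equiv.swap_apply_left] at hswap
    have hx : ‖x 0‖ ^ 2 ≤ ∑ i, ‖x i‖ ^ 2 :=
      Finset.single_le_sum (f := fun i => ‖x i‖ ^ 2) (fun i _ => sq_nonneg _) (Finset.mem_univ 0)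
    have hone := hlen 0
    rw [Fin.succ_zero_eq_one] at hone
    linarith [sq_nonneg ‖x 0‖]

end IsSymplecticFrame

end Frames

theorem exists_bounded_frame (n : ℕ) : ∃ C : ℝ, ∀ (E : Type*) [NormedAddCommGroup E]
    [InnerProductSpace ℂ E] [FiniteDimensional ℂ E], Module.finrank ℂ E = n →
    ∀ e f : Fin n → E, IsSymplecticFrame e f → ∃ a b : Fin n → E, IsSymplecticFrame a b ∧
      frameLattice a b ≤ frameLattice e f ∧ ∑ i, ‖a i‖ ^ 2 ≤ C := by
  induction n with
  | zero => exact ⟨0, fun E _ _ _ _ e f h => ⟨e, f, h, le_rfl, by simp⟩⟩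
  | succ n ih =>
    obtain ⟨C, hC⟩ := ih
    refine ⟨C + (n + 1) * (2 * (C + 1)), fun E _ _ _ hdim e f h => ?_⟩
    obtain ⟨a, b, hab, hle, hmin⟩ := h.exists_almost_minimal
    have hdim' : Module.finrank ℂ (Submodule.span ℂ {a 0})ᗮ = n :=
      haveI : Fact (Module.finrank ℂ E = n + 1) := ⟨hdim⟩
      Submodule.finrank_orthogonal_span_singleton (hab.ne_zero 0)
    obtain ⟨x, y, hxy, hxyle, hsum⟩ := hC _ hdim' _ _ hab.projPerp_tail
    obtain ⟨c, d, hcd, hcdle, hc0, hcs⟩ := hab.exists_lift hxy hxyle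
    have hhead := hab.norm_sq_head_le hmin hdim' hxy hxyle
    refine ⟨c, d, hcd, hcdle.trans hle, ?_⟩
    calc ∑ i, ‖c i‖ ^ 2 = ‖a 0‖ ^ 2 + ∑ i : Fin n, ‖c i.succ‖ ^ 2 := by
          rw [Fin.sum_univ_succ, hc0]
      _ ≤ ‖a 0‖ ^ 2 + ∑ i : Fin n, (‖x i‖ ^ 2 + ‖a 0‖ ^ 2 / 4) := by
          gcongr with i
          exact hcs i
      _ = ‖a 0‖ ^ 2 * (1 + n / 4) + ∑ i, ‖x i‖ ^ 2 := by
          rw [Finset.sum_add_distrib, Finset.sum_const, Finset.card_univ, Fintype.card_fin,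
            nsmul_eq_mul]
          ring
      _ ≤ C + (n + 1) * (2 * (C + 1)) := by
          nlinarith [sq_nonneg ‖a 0‖, (n.cast_nonneg : (0 : ℝ) ≤ n)]

section FrameMatrix

variable {E : Type*} [NormedAddCommGroup E] [InnerProductSpace ℂ E]
  {ι : Type*} [DecidableEq ι] {e f a b : ι → E}

theorem IsSymplecticFrame.imInner_sumElim (h : IsSymplecticFrame e f) (x y : ι ⊕ ι) :
    imInner (Sum.elim f e x) (Sum.elim f e y) = ((Matrix.J ι ℤ x y : ℤ) : ℝ) := by
  rcases x with i | i <;> rcases y with j | j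
  · simp [Matrix.J, h.right]
  · simp [Matrix.J, ← neg_imInner (e j) (f i), h.pair, Matrix.one_apply, eq_comm]
  · simp [Matrix.J, h.pair, Matrix.one_apply]
  · simp [Matrix.J, h.left]

theorem IsSymplecticFrame.exists_symplectic [Fintype ι] (h : IsSymplecticFrame e f)
    (h' : IsSymplecticFrame a b) (hle : frameLattice a b ≤ frameLattice e f) :
    ∃ γ : symplecticGroup ι ℤ, ∀ i, a i =
      ∑ j, (γ : Matrix (ι ⊕ ι) (ι ⊕ ι) ℤ) (Sum.inr i) (Sum.inl j) • f j +
      ∑ j, (γ : Matrix (ι ⊕ ι) (ι ⊕ ι) ℤ) (Sum.inr i) (Sum.inr j) • e j := by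
  have hspan : frameLattice e f = Submodule.span ℤ (Set.range (Sum.elim f e)) := by
    rw [frameLattice, Set.Sum.elim_range, Set.union_comm]
  have hmem : ∀ x, ∃ c : ι ⊕ ι → ℤ, ∑ y, c y • Sum.elim f e y = Sum.elim b a x := by
    intro x
    rw [← Submodule.mem_span_range_iff_exists_fun, ← hspan]
    obtain ⟨ha, hb⟩ := frameLattice_le_iff.1 hle
    rcases x with i | i
    exacts [hb i, ha i]
  choose γ hγ using hmem
  refine ⟨⟨Matrix.of γ, SymplecticGroup.mem_iff.2 ?_⟩, fun i => ?_⟩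
  · ext x y
    have hxy := h'.imInner_sumElim x y
    simp only [← hγ, map_sum, LinearMap.sum_apply, map_zsmul, LinearMap.smul_apply,
      h.imInner_sumElim, zsmul_eq_mul] at hxy
    simp only [Matrix.mul_apply, Matrix.transpose_apply, Matrix.of_apply, Finset.sum_mul]
    rw [← Int.cast_inj (α := ℝ), ← hxy]
    push_cast
    refine Finset.sum_congr rfl fun k _ => ?_
    rw [Finset.mul_sum]
    exact Finset.sum_congr rfl fun l _ => by ring
  · simpa using (hγ (Sum.inr i)).symm

end FrameMatrix

section Rows

variable {m k : Type*} [Fintype k]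

/-- The rows of a complex matrix as vectors of a Euclidean space. -/
noncomputable def rowVec (A : Matrix m k ℂ) (i : m) : EuclideanSpace ℂ k := WithLp.toLp 2 (A i)

theorem inner_rowVec (A B : Matrix m k ℂ) (i j : m) :
    inner ℂ (rowVec A i) (rowVec B j) = (B * Aᴴ) j i := by
  simp [rowVec, Matrix.mul_apply, PiLp.inner_apply]

theorem sum_norm_sq_rowVec [Fintype m] (A : Matrix m k ℂ) :
    ∑ i, ‖rowVec A i‖ ^ 2 = (A * Aᴴ).trace.re := by
  simp [re_trace_mul_conjTranspose, rowVec, EuclideanSpace.norm_sq_eq]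

end Rows

section Reduction

variable {n : ℕ}

/-- The real part `X` of `Z = X + iY`. -/
def rePart (Z : SiegelSpace n) : Matrix (Fin n) (Fin n) ℝ :=
  (Z : Matrix (Fin n) (Fin n) ℂ).map Complex.re

theorem coe_eq_rePart_add_imPart (Z : SiegelSpace n) :
    (Z : Matrix (Fin n) (Fin n) ℂ) =
      (rePart Z).map ((↑) : ℝ → ℂ) + Complex.I • (imPart Z).map ((↑) : ℝ → ℂ) := by
  ext i j
  simp [rePart, imPart, mul_comm Complex.I, Complex.re_add_im]

theorem transpose_rePart (Z : SiegelSpace n) : (rePart Z)ᵀ = rePart Z := by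
  rw [rePart, ← Matrix.transpose_map, Z.2.1]

theorem transpose_imPart (Z : SiegelSpace n) : (imPart Z)ᵀ = imPart Z := by
  rw [imPart, ← Matrix.transpose_map, Z.2.1]

theorem coe_mul_inv_imPart (Z : SiegelSpace n) :
    (Z : Matrix (Fin n) (Fin n) ℂ) * (imPart Z)⁻¹.map ((↑) : ℝ → ℂ) =
      (rePart Z * (imPart Z)⁻¹).map ((↑) : ℝ → ℂ) + Complex.I • 1 := by
  have hY := (Matrix.isUnit_iff_isUnit_det _).1 (imPart_posDef Z).isUnit
  rw [coe_eq_rePart_add_imPart, add_mul, smul_mul_assoc, ← map_ofReal_mul, ← map_ofReal_mul,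
    Matrix.mul_nonsing_inv _ hY, Matrix.map_one _ Complex.ofReal_zero Complex.ofReal_one]

theorem coe_mul_inv_imPart_mul_conjTranspose (Z : SiegelSpace n) :
    (Z : Matrix (Fin n) (Fin n) ℂ) * (imPart Z)⁻¹.map ((↑) : ℝ → ℂ) *
        (Z : Matrix (Fin n) (Fin n) ℂ)ᴴ =
      (rePart Z * (imPart Z)⁻¹ * rePart Z + imPart Z).map ((↑) : ℝ → ℂ) := by
  have hY := (Matrix.isUnit_iff_isUnit_det _).1 (imPart_posDef Z).isUnit
  rw [coe_mul_inv_imPart, coe_eq_rePart_add_imPart, conjTranspose_add, conjTranspose_smul,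
    conjTranspose_map_ofReal, conjTranspose_map_ofReal, transpose_rePart, transpose_imPart,
    add_mul, mul_add, mul_smul_comm, ← map_ofReal_mul, ← map_ofReal_mul,
    Matrix.nonsing_inv_mul_cancel_right _ _ hY]
  ext i j
  simp [← mul_assoc]

theorem isSymplecticFrame_rowVec (Z : SiegelSpace n) {m : Type*} [Fintype m]
    {T : Matrix (Fin n) m ℂ} (hT : T * Tᴴ = (imPart Z)⁻¹.map ((↑) : ℝ → ℂ)) :
    IsSymplecticFrame (rowVec T) (rowVec ((Z : Matrix (Fin n) (Fin n) ℂ) * T)) where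
  left i j := by simp [imInner_apply, inner_rowVec, hT]
  right i j := by
    rw [imInner_apply, inner_rowVec, conjTranspose_mul, ← Matrix.mul_assoc,
      Matrix.mul_assoc (Z : Matrix (Fin n) (Fin n) ℂ), hT, coe_mul_inv_imPart_mul_conjTranspose]
    exact Complex.ofReal_im _
  pair i j := by
    rw [imInner_apply, inner_rowVec, Matrix.mul_assoc, hT, coe_mul_inv_imPart]
    simp [Matrix.one_apply, eq_comm, apply_ite]

/-- `Sp_{2n}(ℤ)` inside `Sp_{2n}(ℝ)`. -/
noncomputable def intToReal (n : ℕ) : symplecticGroup (Fin n) ℤ →* symplecticGroup (Fin n) ℝ :=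
  symplecticMap n (Int.castRingHom ℝ)

theorem ratToReal_symplecticMap (γ : symplecticGroup (Fin n) ℤ) :
    ratToReal n (symplecticMap n (Int.castRingHom ℚ) γ) = intToReal n γ := by
  refine Subtype.ext (Matrix.ext fun i j => ?_)
  simp [ratToReal, intToReal, symplecticMap]

theorem rowVec_denomMatrix_mul (γ : symplecticGroup (Fin n) ℤ) (Z : SiegelSpace n)
    {m : Type*} (T : Matrix (Fin n) m ℂ) (i : Fin n) :
    rowVec (denomMatrix (intToReal n γ) Z * T) i =
      ∑ j, (γ : Matrix (Fin n ⊕ Fin n) (Fin n ⊕ Fin n) ℤ) (Sum.inr i) (Sum.inl j) •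
        rowVec ((Z : Matrix (Fin n) (Fin n) ℂ) * T) j +
      ∑ j, (γ : Matrix (Fin n ⊕ Fin n) (Fin n ⊕ Fin n) ℤ) (Sum.inr i) (Sum.inr j) •
        rowVec T j := by
  ext l
  simp only [denomMatrix, Matrix.add_mul, Matrix.mul_assoc]
  simp [rowVec, blockC, blockD, intToReal, symplecticMap, Matrix.toBlocks₂₁, Matrix.toBlocks₂₂,
    Matrix.mul_apply (N := T), Matrix.mul_apply (N := (Z : Matrix (Fin n) (Fin n) ℂ) * T)]

theorem exists_reduced_point (n : ℕ) : ∃ R : ℝ, ∀ Z : SiegelSpace n,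
    ∃ γ : symplecticGroup (Fin n) ℤ, (imPart (moebius (intToReal n γ) Z))⁻¹.trace ≤ R := by
  obtain ⟨R, hR⟩ := exists_bounded_frame n
  refine ⟨R, fun Z => ?_⟩
  -- The rows of `T = Y^{-1/2}` and of `ZT` form a frame, which `γ` takes to one starting with the
  -- rows of `(CZ + D)T`.
  set T := (posDefSqrt (imPart Z) (imPart_posDef Z))⁻¹.val with hTdef
  have hT : T * Tᴴ = (imPart Z)⁻¹.map ((↑) : ℝ → ℂ) := by
    rw [map_ofReal_inv (imPart_posDef Z).isUnit, ← posDefSqrt_mul_self (imPart_posDef Z),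
      Matrix.mul_inv_rev, hTdef, Matrix.coe_units_inv, Matrix.conjTranspose_nonsing_inv,
      conjTranspose_posDefSqrt]
  have hframe := isSymplecticFrame_rowVec Z hT
  obtain ⟨a, b, hab, hle, hsum⟩ := hR (EuclideanSpace ℂ (Fin n)) (by simp) _ _ hframe
  obtain ⟨γ, hγ⟩ := hframe.exists_symplectic hab hle
  have ha : a = rowVec (sqrtFactor (intToReal n γ) Z)⁻¹.val := by
    funext i
    rw [hγ, coe_inv_sqrtFactor, rowVec_denomMatrix_mul]
  refine ⟨γ, ?_⟩
  rwa [← re_trace_map_ofReal, ← inv_sqrtFactor_mul_conjTranspose, ← sum_norm_sq_rowVec, ← ha]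

end Reduction

/-! ### Lower bound for the determinant of the factor of automorphy -/

section Harnack

/-- The Harnack factor comparing the moduli at `z` and at `i` of an affine function without zeros
in the upper half plane. -/
noncomputable def harnack (z : ℂ) : ℝ := z.im / (z.im + ‖z - Complex.I‖)

theorem harnack_nonneg {z : ℂ} (hz : 0 < z.im) : 0 ≤ harnack z := by
  rw [harnack]
  positivity

theorem harnack_le_one {z : ℂ} (hz : 0 < z.im) : harnack z ≤ 1 :=
  div_le_one_of_le₀ (le_add_of_nonneg_right (norm_nonneg _)) (by positivity)

theorem min_div_two_le_harnack {μ : ℝ} (hμ : 0 < μ) :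
    min μ 1 / 2 ≤ harnack (μ * Complex.I) := by
  have him : (μ * Complex.I : ℂ).im = μ := by simp
  have hnorm : ‖(μ * Complex.I - Complex.I : ℂ)‖ = |μ - 1| := by
    rw [← sub_one_mul, norm_mul, Complex.norm_I, mul_one, ← Complex.ofReal_one,
      ← Complex.ofReal_sub, Complex.norm_real, Real.norm_eq_abs]
  rw [harnack, him, hnorm, div_le_div_iff₀ two_pos (by positivity)]
  rcases le_total μ 1 with h | h
  · rw [min_eq_left h, abs_of_nonpos (by linarith)]
    linarith
  · rw [min_eq_right h, abs_of_nonneg (by linarith)]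
    linarith

theorem harnack_ofReal_add_I (x : ℝ) : harnack (x + Complex.I) = (1 + |x|)⁻¹ := by
  simp [harnack]

theorem harnack_mul_norm_le {α β z : ℂ} (hne : ∀ w : ℂ, 0 < w.im → α + β * w ≠ 0)
    (hz : 0 < z.im) : harnack z * ‖α + β * Complex.I‖ ≤ ‖α + β * z‖ := by
  rcases eq_or_ne β 0 with rfl | hβ
  · simpa using mul_le_of_le_one_left (norm_nonneg α) (harnack_le_one hz)
  obtain ⟨r, rfl⟩ : ∃ r, α = -(β * r) := ⟨-(α / β), by field_simp⟩
  have hr : r.im ≤ 0 := by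
    by_contra! h
    exact hne r h (by ring)
  have hfactor : ∀ w : ℂ, ‖-(β * r) + β * w‖ = ‖β‖ * ‖w - r‖ := fun w => by
    rw [← norm_mul]
    ring_nf
  have him : z.im ≤ ‖z - r‖ :=
    calc z.im ≤ (z - r).im := by rw [Complex.sub_im]; linarith
      _ ≤ ‖z - r‖ := (le_abs_self _).trans (Complex.abs_im_le_norm _)
  have htri : ‖Complex.I - r‖ ≤ ‖z - r‖ + ‖z - Complex.I‖ := by
    rw [add_comm, norm_sub_rev z Complex.I]
    exact norm_sub_le_norm_sub_add_norm_sub _ _ _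
  rw [hfactor, hfactor, harnack, div_mul_eq_mul_div, div_le_iff₀ (by positivity)]
  calc z.im * (‖β‖ * ‖Complex.I - r‖)
      ≤ z.im * (‖β‖ * (‖z - r‖ + ‖z - Complex.I‖)) := by gcongr
    _ = ‖β‖ * (z.im * ‖z - r‖ + z.im * ‖z - Complex.I‖) := by ring
    _ ≤ ‖β‖ * (z.im * ‖z - r‖ + ‖z - r‖ * ‖z - Complex.I‖) := by gcongr
    _ = ‖β‖ * ‖z - r‖ * (z.im + ‖z - Complex.I‖) := by ring

theorem prod_harnack_mul_norm_le {ι : Type*} [Fintype ι] [DecidableEq ι] {f : (ι → ℂ) → ℂ}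
    (haff : ∀ z a, ∃ α β : ℂ, ∀ w, f (Function.update z a w) = α + β * w)
    (hne : ∀ z, (∀ i, 0 < (z i).im) → f z ≠ 0) {z : ι → ℂ} (hz : ∀ i, 0 < (z i).im) :
    (∏ i, harnack (z i)) * ‖f fun _ => Complex.I‖ ≤ ‖f z‖ := by
  suffices key : ∀ s : Finset ι, (∏ i ∈ s, harnack (z i)) * ‖f fun _ => Complex.I‖ ≤
      ‖f (s.piecewise z fun _ => Complex.I)‖ by simpa using key Finset.univ
  intro s
  induction s using Finset.induction_on with
  | empty => simp
  | insert a s ha ih =>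
    set y := s.piecewise z fun _ => Complex.I
    have hy : ∀ i, 0 < (y i).im := fun i =>
      s.piecewise_cases z _ (fun w => 0 < w.im) (hz i) (by simp)
    obtain ⟨α, β, hf⟩ := haff y a
    have hne' : ∀ w : ℂ, 0 < w.im → α + β * w ≠ 0 := fun w hw => by
      rw [← hf]
      refine hne _ ((Function.forall_update_iff y fun _ w => 0 < w.im).2 ⟨hw, fun i _ => hy i⟩)
    have hfy : f y = α + β * Complex.I := by
      rw [← hf, ← show y a = Complex.I from s.piecewise_eq_of_notMem _ _ ha,
        Function.update_eq_self]
    rw [hfy] at ih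
    rw [Finset.prod_insert ha, Finset.piecewise_insert, hf, mul_assoc]
    exact (mul_le_mul_of_nonneg_left ih (harnack_nonneg (hz a))).trans
      (harnack_mul_norm_le hne' (hz a))

theorem exists_det_mul_diagonal_update {ι R : Type*} [Fintype ι] [DecidableEq ι] [CommRing R]
    (M N : Matrix ι ι R) (z : ι → R) (a : ι) : ∃ α β : R, ∀ w : R,
      (M + N * diagonal (Function.update z a w)).det = α + β * w := by
  set P := M + N * diagonal z
  refine ⟨(P.updateCol a fun i => M i a).det, (P.updateCol a fun i => N i a).det, fun w => ?_⟩
  rw [mul_comm, ← Matrix.det_updateCol_smul, ← Matrix.det_updateCol_add]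
  congr 1
  ext i j
  rcases eq_or_ne j a with rfl | hj
  · simp [mul_comm]
  · simp [P, hj]

end Harnack

section Determinant

variable {n : ℕ}

theorem exists_orthogonal_diagonalization {ι : Type*} [Fintype ι] [DecidableEq ι]
    {A : Matrix ι ι ℝ} (hA : A.IsHermitian) :
    ∃ Q : Matrix ι ι ℝ, Q * Qᵀ = 1 ∧ Q * diagonal hA.eigenvalues * Qᵀ = A :=
  ⟨hA.eigenvectorUnitary, Unitary.mul_star_self_of_mem hA.eigenvectorUnitary.2,
    hA.spectral_theorem.symm⟩

theorem abs_eigenvalues_le {ι : Type*} [Fintype ι] [DecidableEq ι] {A : Matrix ι ι ℝ}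
    (hA : A.IsHermitian) {c : ℝ} (hc : ∀ i j, |A i j| ≤ c) (i : ι) :
    |hA.eigenvalues i| ≤ Fintype.card ι * c := by
  have hμ : Module.End.HasEigenvalue (Matrix.toLin' A) (hA.eigenvalues i) := by
    rw [Module.End.hasEigenvalue_iff_mem_spectrum, Matrix.spectrum_toLin']
    exact hA.eigenvalues_mem_spectrum_real i
  obtain ⟨k, hk⟩ := eigenvalue_mem_ball hμ
  calc |hA.eigenvalues i| ≤ ‖A k k‖ + ∑ j ∈ Finset.univ.erase k, ‖A k j‖ :=
        norm_le_of_mem_closedBall hk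
    _ = ∑ j, ‖A k j‖ := Finset.add_sum_erase _ (fun j => ‖A k j‖) (Finset.mem_univ k)
    _ ≤ Finset.univ.card • c := Finset.sum_le_card_nsmul _ _ _ fun j _ => hc k j
    _ = Fintype.card ι * c := by rw [Finset.card_univ, nsmul_eq_mul]

theorem add_mul_diagonal_mul_transpose_mem {W Q : Matrix (Fin n) (Fin n) ℝ} (hW : Wᵀ = W)
    (hQ : IsUnit Q) {z : Fin n → ℂ} (hz : ∀ i, 0 < (z i).im) :
    W.map ((↑) : ℝ → ℂ) + Q.map ((↑) : ℝ → ℂ) * diagonal z * (Q.map ((↑) : ℝ → ℂ))ᵀ ∈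
      siegelSet n := by
  constructor
  · simp only [transpose_add, transpose_mul, transpose_transpose, diagonal_transpose,
      Matrix.mul_assoc, ← transpose_map, hW]
  · have him : (W.map ((↑) : ℝ → ℂ) + Q.map ((↑) : ℝ → ℂ) * diagonal z *
        (Q.map ((↑) : ℝ → ℂ))ᵀ).map Complex.im = Q * diagonal (fun i => (z i).im) * Qᴴ := by
      ext i j
      simp [Matrix.mul_apply, Matrix.diagonal_apply]
    rw [him]
    exact (PosDef.diagonal hz).mul_mul_conjTranspose_same (Matrix.vecMul_injective_iff_isUnit.2 hQ)

theorem add_I_smul_one_mem {X : Matrix (Fin n) (Fin n) ℝ} (hX : Xᵀ = X) :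
    X.map ((↑) : ℝ → ℂ) + Complex.I • 1 ∈ siegelSet n := by
  have h := add_mul_diagonal_mul_transpose_mem hX isUnit_one
    (z := fun _ => Complex.I) fun _ => by simp
  rwa [Matrix.map_one _ Complex.ofReal_zero Complex.ofReal_one, one_mul, transpose_one, mul_one,
    ← Matrix.smul_one_eq_diagonal] at h

theorem prod_harnack_mul_norm_det_le (g : symplecticGroup (Fin n) ℝ)
    {W A : Matrix (Fin n) (Fin n) ℝ} (hW : Wᵀ = W) (hA : A.IsHermitian) {c x : ℂ}
    (hz : ∀ i, 0 < (hA.eigenvalues i * c + x).im) :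
    (∏ i, harnack (hA.eigenvalues i * c + x)) *
        ‖(blockC g * (W.map ((↑) : ℝ → ℂ) + Complex.I • 1) + blockD g).det‖ ≤
      ‖(blockC g * (W.map ((↑) : ℝ → ℂ) + (c • A.map ((↑) : ℝ → ℂ) + x • 1)) +
        blockD g).det‖ := by
  obtain ⟨Q, hQ, hdiag⟩ := exists_orthogonal_diagonalization hA
  set T : Matrix (Fin n) (Fin n) ℂ := Q.map (↑) with hTdef
  have hT : T * Tᵀ = 1 := by
    rw [hTdef, ← transpose_map, ← map_ofReal_mul, hQ,
      Matrix.map_one _ Complex.ofReal_zero Complex.ofReal_one]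
  have hpoint : ∀ c x : ℂ, T * diagonal (fun i => hA.eigenvalues i * c + x) * Tᵀ =
      c • A.map (↑) + x • 1 := fun c x => by
    have hz : diagonal (fun i => (hA.eigenvalues i : ℂ) * c + x) =
        c • (diagonal hA.eigenvalues).map (↑) + x • 1 := by
      ext i j
      by_cases h : i = j <;> simp [h, mul_comm]
    have hmap : A.map ((↑) : ℝ → ℂ) = T * (diagonal hA.eigenvalues).map (↑) * Tᵀ := by
      rw [hTdef, ← transpose_map, ← map_ofReal_mul, ← map_ofReal_mul, hdiag]
    rw [hz, hmap, mul_add, add_mul, mul_smul_comm, mul_smul_comm, smul_mul_assoc,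
      smul_mul_assoc, mul_one, hT]
  have haff : ∀ z a, ∃ α β : ℂ, ∀ w,
      (blockC g * (W.map ((↑) : ℝ → ℂ) + T * diagonal (Function.update z a w) * Tᵀ) +
        blockD g).det = α + β * w := fun z a => by
    obtain ⟨α, β, h⟩ := exists_det_mul_diagonal_update
      ((blockC g * W.map ((↑) : ℝ → ℂ) + blockD g) * T) (blockC g * T) z a
    refine ⟨α * Tᵀ.det, β * Tᵀ.det, fun w => ?_⟩
    rw [mul_right_comm, ← add_mul, ← h, ← Matrix.det_mul, add_mul, mul_assoc _ T, hT]
    noncomm_ring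
  have hne : ∀ z : Fin n → ℂ, (∀ i, 0 < (z i).im) →
      (blockC g * (W.map ((↑) : ℝ → ℂ) + T * diagonal z * Tᵀ) + blockD g).det ≠ 0 := fun z hz =>
    (isUnit_det_denomMatrix g
      ⟨_, add_mul_diagonal_mul_transpose_mem hW (IsUnit.of_mul_eq_one _ hQ) hz⟩).ne_zero
  have hbase := hpoint 0 Complex.I
  simp only [mul_zero, zero_add, zero_smul] at hbase
  have h := prod_harnack_mul_norm_le haff hne hz
  rwa [hpoint, hbase] at h

theorem one_le_norm_det_I (γ : symplecticGroup (Fin n) ℤ) :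
    1 ≤ ‖(blockC (intToReal n γ) * (Complex.I • 1) + blockD (intToReal n γ)).det‖ := by
  set M : Matrix (Fin n) (Fin n) GaussianInt := Matrix.of fun i j =>
    (⟨(γ : Matrix (Fin n ⊕ Fin n) (Fin n ⊕ Fin n) ℤ) (Sum.inr i) (Sum.inr j),
      (γ : Matrix (Fin n ⊕ Fin n) (Fin n ⊕ Fin n) ℤ) (Sum.inr i) (Sum.inl j)⟩ : GaussianInt)
  have hM : blockC (intToReal n γ) * (Complex.I • 1) + blockD (intToReal n γ) =
      GaussianInt.toComplex.mapMatrix M := by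
    ext i j
    simp [M, GaussianInt.toComplex_def, blockC, blockD, intToReal, symplecticMap,
      Matrix.toBlocks₂₁, Matrix.toBlocks₂₂, mul_comm, add_comm]
  have hne : M.det ≠ 0 := fun h => by
    have hu := isUnit_det_denomMatrix (intToReal n γ) ⟨_, add_I_smul_one_mem transpose_zero⟩
    simp only [denomMatrix, Matrix.map_zero _ Complex.ofReal_zero, zero_add] at hu
    rw [hM, ← RingHom.map_det, h, map_zero] at hu
    exact not_isUnit_zero hu
  have hnorm : (1 : ℝ) ≤ (M.det.norm : ℝ) := by exact_mod_cast GaussianInt.norm_pos.2 hne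
  rw [GaussianInt.intCast_real_norm, Complex.normSq_eq_norm_sq, RingHom.map_det, ← hM] at hnorm
  exact (one_le_sq_iff₀ (norm_nonneg _)).1 hnorm

theorem inv_pow_le_norm_det_of_abs_le (γ : symplecticGroup (Fin n) ℤ)
    {X : Matrix (Fin n) (Fin n) ℝ} (hX : Xᵀ = X) (hX1 : ∀ i j, |X i j| ≤ 1) :
    (1 + (n : ℝ))⁻¹ ^ n ≤ ‖(blockC (intToReal n γ) *
      (X.map ((↑) : ℝ → ℂ) + Complex.I • 1) + blockD (intToReal n γ)).det‖ := by
  have hH : X.IsHermitian := by rw [Matrix.IsHermitian, conjTranspose_eq_transpose_of_trivial, hX]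
  have h := prod_harnack_mul_norm_det_le (intToReal n γ) transpose_zero hH (c := 1)
    (x := Complex.I) fun i => by simp
  simp only [mul_one, one_smul, Matrix.map_zero _ Complex.ofReal_zero, zero_add,
    harnack_ofReal_add_I] at h
  calc (1 + (n : ℝ))⁻¹ ^ n = ∏ _i : Fin n, (1 + (n : ℝ))⁻¹ := by simp
    _ ≤ ∏ i, (1 + |hH.eigenvalues i|)⁻¹ := by
      gcongr with i
      simpa using abs_eigenvalues_le hH hX1 i
    _ ≤ _ := le_mul_of_one_le_right (by positivity) (one_le_norm_det_I γ)
    _ ≤ _ := h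

/-- The element of `Sp_{2n}(ℤ)` acting by `Z ↦ Z + S`. -/
def translation (S : Matrix (Fin n) (Fin n) ℤ) (hS : Sᵀ = S) : symplecticGroup (Fin n) ℤ :=
  ⟨fromBlocks 1 S 0 1, by simp [SymplecticGroup.fromBlocks_mem_iff, hS]⟩

theorem denomMatrix_translation {S : Matrix (Fin n) (Fin n) ℤ} (hS : Sᵀ = S) (Z : SiegelSpace n) :
    denomMatrix (intToReal n (translation S hS)) Z = 1 := by
  ext i j
  simp [denomMatrix, blockC, blockD, translation, intToReal, symplecticMap, Matrix.mul_apply,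
    Matrix.toBlocks₂₁, Matrix.toBlocks₂₂, Matrix.one_apply, apply_ite]

theorem coe_moebius_translation {S : Matrix (Fin n) (Fin n) ℤ} (hS : Sᵀ = S) (Z : SiegelSpace n) :
    (moebius (intToReal n (translation S hS)) Z : Matrix (Fin n) (Fin n) ℂ) =
      (Z : Matrix (Fin n) (Fin n) ℂ) + S.map (↑) := by
  have h := coe_moebius_mul_denomMatrix (intToReal n (translation S hS)) Z
  rw [denomMatrix_translation, mul_one] at h
  rw [h]
  ext i j
  simp [numMatrix, blockA, blockB, translation, intToReal, symplecticMap, Matrix.mul_apply,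
    Matrix.toBlocks₁₁, Matrix.toBlocks₁₂, Matrix.one_apply, apply_ite]

theorem inv_pow_le_norm_det (γ : symplecticGroup (Fin n) ℤ) {X : Matrix (Fin n) (Fin n) ℝ}
    (hX : Xᵀ = X) : (1 + (n : ℝ))⁻¹ ^ n ≤ ‖(blockC (intToReal n γ) *
      (X.map ((↑) : ℝ → ℂ) + Complex.I • 1) + blockD (intToReal n γ)).det‖ := by
  set S : Matrix (Fin n) (Fin n) ℤ := X.map round with hSdef
  have hS : Sᵀ = S := by rw [hSdef, ← transpose_map, hX]
  have hXS : (X - S.map (↑))ᵀ = X - S.map (↑) := by rw [transpose_sub, hX, ← transpose_map, hS]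
  set t := translation S hS
  set Z : SiegelSpace n := ⟨_, add_I_smul_one_mem hXS⟩ with hZ
  have hmoebius : (moebius (intToReal n t) Z : Matrix (Fin n) (Fin n) ℂ) =
      X.map ((↑) : ℝ → ℂ) + Complex.I • 1 := by
    rw [coe_moebius_translation, hZ]
    ext i j
    simp only [Matrix.add_apply, map_apply, Matrix.sub_apply, Complex.ofReal_sub,
      Complex.ofReal_intCast, Matrix.smul_apply, smul_eq_mul]
    ring
  have hdenom : denomMatrix (intToReal n (γ * t)) Z =
      blockC (intToReal n γ) * (X.map ((↑) : ℝ → ℂ) + Complex.I • 1) + blockD (intToReal n γ) := by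
    rw [map_mul, denomMatrix_mul, denomMatrix_translation, mul_one, denomMatrix, hmoebius]
  rw [← hdenom]
  exact inv_pow_le_norm_det_of_abs_le (γ * t) hXS fun i j =>
    (abs_sub_round (X i j)).trans (by norm_num)

theorem prod_min_le_norm_det_denomMatrix (γ : symplecticGroup (Fin n) ℤ) (Z : SiegelSpace n) :
    (2 * (1 + (n : ℝ)))⁻¹ ^ n * ∏ i, min ((imPart_posDef Z).isHermitian.eigenvalues i) 1 ≤
      ‖(denomMatrix (intToReal n γ) Z).det‖ := by
  set μ := (imPart_posDef Z).isHermitian.eigenvalues with hμ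
  have hpos : ∀ i, 0 < μ i := (imPart_posDef Z).eigenvalues_pos
  have h := prod_harnack_mul_norm_det_le (intToReal n γ) (transpose_rePart Z)
    (imPart_posDef Z).isHermitian (c := Complex.I) (x := 0) fun i => by simpa using hpos i
  rw [zero_smul, add_zero, ← coe_eq_rePart_add_imPart, ← hμ] at h
  simp only [add_zero] at h
  calc (2 * (1 + (n : ℝ)))⁻¹ ^ n * ∏ i, min (μ i) 1
      = (∏ i, min (μ i) 1 / 2) * (1 + (n : ℝ))⁻¹ ^ n := by
        rw [Finset.prod_div_distrib, Finset.prod_const, Finset.card_univ, Fintype.card_fin,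
          mul_inv, mul_pow, inv_pow 2]
        ring
    _ ≤ (∏ i, harnack (μ i * Complex.I)) * _ := by
        refine mul_le_mul (Finset.prod_le_prod (fun i _ => ?_) fun i _ =>
          min_div_two_le_harnack (hpos i)) (inv_pow_le_norm_det γ (transpose_rePart Z))
          (by positivity) (Finset.prod_nonneg fun i _ => harnack_nonneg (by simpa using hpos i))
        have := hpos i
        positivity
    _ ≤ ‖(denomMatrix (intToReal n γ) Z).det‖ := h

end Determinant

/-! ### Growth of irreducible representations of `GL_n(ℂ)` -/

theorem exists_unitary_mul_blockTriangular {n : ℕ} (A : GL (Fin n) ℂ) : ∃ k b : GL (Fin n) ℂ,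
    k.val ∈ unitaryGroup (Fin n) ℂ ∧ b.val.BlockTriangular id ∧ A = k * b := by
  set f : Fin n → EuclideanSpace ℂ (Fin n) := fun j => WithLp.toLp 2 fun i => A i j with hf
  have hcard : Module.finrank ℂ (EuclideanSpace ℂ (Fin n)) = Fintype.card (Fin n) := by simp
  set q := InnerProductSpace.gramSchmidtOrthonormalBasis hcard f with hq
  set U := (EuclideanSpace.basisFun (Fin n) ℂ).toBasis.toMatrix q with hU
  have hmem : U ∈ unitaryGroup (Fin n) ℂ :=
    (EuclideanSpace.basisFun (Fin n) ℂ).toMatrix_orthonormalBasis_mem_unitary q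
  let k : GL (Fin n) ℂ := ⟨U, star U, Unitary.mul_star_self_of_mem hmem,
    Unitary.star_mul_self_of_mem hmem⟩
  refine ⟨k, k⁻¹ * A, hmem, fun i j hij => ?_, (mul_inv_cancel_left k A).symm⟩
  change (star U * A.val) i j = 0
  rw [← InnerProductSpace.gramSchmidtOrthonormalBasis_inv_triangular hcard f
    (show j < i from hij), ← hq]
  simp [hU, hf, Matrix.mul_apply, Module.Basis.toMatrix_apply, Matrix.star_apply,
    PiLp.inner_apply, mul_comm]

theorem mul_apply_self_of_blockTriangular {m R : Type*} [Fintype m] [LinearOrder m]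
    [NonUnitalNonAssocSemiring R] {A B : Matrix m m R} (hA : A.BlockTriangular id)
    (hB : B.BlockTriangular id) (i : m) : (A * B) i i = A i i * B i i := by
  rw [Matrix.mul_apply]
  refine Finset.sum_eq_single i (fun j _ hj => ?_) (by simp)
  rcases lt_or_gt_of_ne hj with hj | hj
  · rw [hA hj, zero_mul]
  · rw [hB hj, mul_zero]

theorem inv_apply_self_of_blockTriangular {m 𝕜 : Type*} [Fintype m] [LinearOrder m] [Field 𝕜]
    {b : GL m 𝕜} (hb : b.val.BlockTriangular id) (i : m) : b⁻¹.val i i = (b.val i i)⁻¹ := by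
  have hinv : b⁻¹.val.BlockTriangular id := by
    have := b.invertible
    rw [Matrix.coe_units_inv]
    exact blockTriangular_inv_of_blockTriangular hb
  refine eq_inv_of_mul_eq_one_left ?_
  rw [← mul_apply_self_of_blockTriangular hinv hb, ← Units.val_mul, inv_mul_cancel,
    Units.val_one, Matrix.one_apply_eq]

theorem norm_mul_apply_le {l m k R : Type*} [Fintype m] [NonUnitalSeminormedRing R]
    {A : Matrix l m R} {B : Matrix m k R} {a b : ℝ}
    (hA : ∀ i j, ‖A i j‖ ≤ a) (hB : ∀ i j, ‖B i j‖ ≤ b) (i : l) (j : k) :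
    ‖(A * B) i j‖ ≤ Fintype.card m * (a * b) := by
  rw [Matrix.mul_apply, ← nsmul_eq_mul]
  refine (norm_sum_le _ _).trans (Finset.sum_le_card_nsmul _ _ _ fun r _ => ?_)
  refine (norm_mul_le _ _).trans ?_
  exact mul_le_mul (hA i r) (hB r j) (norm_nonneg _) ((norm_nonneg _).trans (hA i r))

theorem zpow_le_zpow_sub_mul_zpow {x R : ℝ} (hx : 0 < x) (hR : x⁻¹ ≤ R) {k m : ℤ} (hkm : k ≤ m) :
    x ^ k ≤ R ^ (m - k) * x ^ m :=
  calc x ^ k = x⁻¹ ^ (m - k) * x ^ m := by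
        rw [_root_.inv_zpow', ← zpow_add₀ hx.ne', neg_sub, sub_add_cancel]
    _ ≤ R ^ (m - k) * x ^ m := by
        gcongr
        exact zpow_le_zpow_left₀ (sub_nonneg.2 hkm) (inv_nonneg.2 hx.le) hR

section Representation

variable {n : ℕ} {V : Type*} [NormedAddCommGroup V] [NormedSpace ℂ V]
  {ρ : Representation ℂ (GL (Fin n) ℂ) V} {lam : Fin n → ℤ} {m : ℤ}

theorem norm_apply_highestWeightVector_le
    (hnorm : ∀ U : GL (Fin n) ℂ, U.val ∈ unitaryGroup (Fin n) ℂ → ∀ v, ‖ρ U v‖ = ‖v‖)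
    (hm : ∀ i, lam i ≤ m) {v : V}
    (hv : ∀ b : GL (Fin n) ℂ, b.val.BlockTriangular id → ρ b v = (∏ i, b.val i i ^ lam i) • v)
    {K : ℝ} {h : GL (Fin n) ℂ} (hK : ∀ i j, ‖h⁻¹.val i j‖ ≤ K) :
    ‖ρ h v‖ ≤ (∏ i, (n * K) ^ (m - lam i)) * ‖h.val.det‖ ^ m * ‖v‖ := by
  obtain ⟨k, b, hk, hb, rfl⟩ := exists_unitary_mul_blockTriangular h
  have hdiag (i : Fin n) : 0 < ‖b.val i i‖ := by
    have hdet := b.isUnit.map Matrix.detMonoidHom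
    rw [Matrix.coe_detMonoidHom, Matrix.det_of_isUpperTriangular hb] at hdet
    exact norm_pos_iff.2 (Finset.prod_ne_zero_iff.1 hdet.ne_zero i (Finset.mem_univ i))
  have hinv (i : Fin n) : ‖b.val i i‖⁻¹ ≤ n * K := by
    have hb' : b⁻¹ = (k * b)⁻¹ * k := by
      rw [_root_.mul_inv_rev, inv_mul_cancel_right]
    have hle := norm_mul_apply_le hK (entry_norm_bound_of_unitary hk) i i
    rwa [← Units.val_mul, ← hb', inv_apply_self_of_blockTriangular hb, norm_inv, mul_one,
      Fintype.card_fin] at hle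
  have hdet : ‖(k * b).val.det‖ = ∏ i, ‖b.val i i‖ := by
    have hk1 : ‖k.val.det‖ = 1 := CStarRing.norm_of_mem_unitary (Matrix.det_of_mem_unitary hk)
    rw [Units.val_mul, Matrix.det_mul, norm_mul, hk1, one_mul,
      Matrix.det_of_isUpperTriangular hb, norm_prod]
  calc ‖ρ (k * b) v‖ = (∏ i, ‖b.val i i‖ ^ lam i) * ‖v‖ := by
        simp only [map_mul, Module.End.mul_apply, hnorm k hk, hv b hb, norm_smul, norm_prod,
          norm_zpow]
    _ ≤ (∏ i, ((n * K) ^ (m - lam i) * ‖b.val i i‖ ^ m)) * ‖v‖ := by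
        gcongr with i
        exact zpow_le_zpow_sub_mul_zpow (hdiag i) (hinv i) (hm i)
    _ = _ := by rw [Finset.prod_mul_distrib, Finset.prod_zpow, hdet]

/-- The vectors `x` for which `‖ρ(h) x‖` is at most a constant times `|det h|^m`, uniformly over the
`h` for which `h⁻¹` has bounded entries; this is a subrepresentation. -/
def detGrowth (ρ : Representation ℂ (GL (Fin n) ℂ) V) (m : ℤ) : Subrepresentation ρ where
  toSubmodule :=
    { carrier := {x | ∀ K : ℝ, ∃ C : ℝ, ∀ h : GL (Fin n) ℂ, (∀ i j, ‖h⁻¹.val i j‖ ≤ K) →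
        ‖ρ h x‖ ≤ C * ‖h.val.det‖ ^ m}
      zero_mem' := fun _ => ⟨0, fun h _ => by simp⟩
      add_mem' := fun hx hy K => by
        obtain ⟨C, hC⟩ := hx K
        obtain ⟨D, hD⟩ := hy K
        refine ⟨C + D, fun h hh => ?_⟩
        rw [map_add, add_mul]
        exact norm_add_le_of_le (hC h hh) (hD h hh)
      smul_mem' := fun c x hx K => by
        obtain ⟨C, hC⟩ := hx K
        refine ⟨‖c‖ * C, fun h hh => ?_⟩
        rw [map_smul, norm_smul, mul_assoc]
        exact mul_le_mul_of_nonneg_left (hC h hh) (norm_nonneg c) }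
  apply_mem_toSubmodule g x hx K := by
    obtain ⟨a, ha⟩ := Finite.exists_le fun q : Fin n × Fin n => ‖g⁻¹.val q.1 q.2‖
    obtain ⟨C, hC⟩ := hx (Fintype.card (Fin n) * (a * K))
    refine ⟨C * ‖g.val.det‖ ^ m, fun h hh => ?_⟩
    have hhg : ∀ i j, ‖(h * g)⁻¹.val i j‖ ≤ Fintype.card (Fin n) * (a * K) := by
      rw [_root_.mul_inv_rev, Units.val_mul]
      exact norm_mul_apply_le (fun i j => ha (i, j)) hh
    calc ‖ρ h (ρ g x)‖ = ‖ρ (h * g) x‖ := by rw [map_mul, Module.End.mul_apply]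
      _ ≤ C * ‖(h * g).val.det‖ ^ m := hC _ hhg
      _ = C * ‖g.val.det‖ ^ m * ‖h.val.det‖ ^ m := by
        rw [Units.val_mul, Matrix.det_mul, norm_mul, mul_zpow]
        ring

theorem detGrowth_eq_top (hirr : ρ.IsIrreducible)
    (hnorm : ∀ U : GL (Fin n) ℂ, U.val ∈ unitaryGroup (Fin n) ℂ → ∀ v, ‖ρ U v‖ = ‖v‖)
    (hlam : IsHighestWeight ρ lam) (hm : ∀ i, lam i ≤ m) : detGrowth ρ m = ⊤ := by
  obtain ⟨v, hv0, hv⟩ := hlam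
  have hmem : v ∈ (detGrowth ρ m).toSubmodule := fun K =>
    ⟨(∏ i, (n * K) ^ (m - lam i)) * ‖v‖, fun h hh =>
      (norm_apply_highestWeightVector_le hnorm hm hv hh).trans_eq (by ring)⟩
  refine (hirr.eq_bot_or_eq_top _).resolve_left fun hbot => hv0 ?_
  rw [hbot] at hmem
  exact (Submodule.mem_bot ℂ).1 hmem

theorem exists_norm_apply_le_det_zpow [FiniteDimensional ℂ V] (hirr : ρ.IsIrreducible)
    (hnorm : ∀ U : GL (Fin n) ℂ, U.val ∈ unitaryGroup (Fin n) ℂ → ∀ v, ‖ρ U v‖ = ‖v‖)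
    (hlam : IsHighestWeight ρ lam) (hm : ∀ i, lam i ≤ m) (K : ℝ) :
    ∃ C : ℝ, ∀ h : GL (Fin n) ℂ, (∀ i j, ‖h⁻¹.val i j‖ ≤ K) →
      ∀ x : V, ‖ρ h x‖ ≤ C * ‖h.val.det‖ ^ m * ‖x‖ := by
  have hgrowth (x : V) : x ∈ (detGrowth ρ m).toSubmodule := by
    rw [detGrowth_eq_top hirr hnorm hlam hm]
    exact Submodule.mem_top
  choose c hc using fun x => hgrowth x K
  let B := Module.finBasis ℂ V
  obtain ⟨D, -, hop⟩ := B.exists_opNorm_le (F := V)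
  obtain ⟨M, hM⟩ := Finite.exists_le fun i => c (B i)
  refine ⟨D * max M 0, fun h hh x => ?_⟩
  have hB (i) : ‖LinearMap.toContinuousLinearMap (ρ h) (B i)‖ ≤ max M 0 * ‖h.val.det‖ ^ m :=
    (hc (B i) h hh).trans (by gcongr; exact (hM i).trans (le_max_left M 0))
  have h0 : 0 ≤ max M 0 * ‖h.val.det‖ ^ m := by positivity
  calc ‖ρ h x‖ ≤ ‖LinearMap.toContinuousLinearMap (ρ h)‖ * ‖x‖ :=
        (LinearMap.toContinuousLinearMap (ρ h)).le_opNorm x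
    _ ≤ D * (max M 0 * ‖h.val.det‖ ^ m) * ‖x‖ := by
        gcongr
        exact hop h0 hB
    _ = _ := by ring

end Representation

/-! ### Boundedness from the Fourier expansion -/

section Trace

variable {l m k : Type*} [Fintype l] [Fintype m] [Fintype k]

theorem trace_conjTranspose_mul_self (A : Matrix m k ℝ) :
    (Aᴴ * A).trace = ∑ i, ∑ j, A i j ^ 2 := by
  rw [Finset.sum_comm]
  simp [Matrix.trace, Matrix.mul_apply, sq]

theorem trace_conjTranspose_mul_self_mul_le (A : Matrix l m ℝ) (B : Matrix m k ℝ) :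
    ((A * B)ᴴ * (A * B)).trace ≤ (Aᴴ * A).trace * (Bᴴ * B).trace := by
  simp only [trace_conjTranspose_mul_self, Matrix.mul_apply]
  rw [Finset.sum_comm (f := fun i j => B i j ^ 2), Finset.sum_mul_sum]
  gcongr
  exact Finset.sum_mul_sq_le_sq_mul_sq _ _ _

open scoped MatrixOrder in
theorem exists_isHermitian_mul_self_eq {S : Matrix m m ℝ} (hS : S.PosSemidef) :
    ∃ T : Matrix m m ℝ, Tᴴ = T ∧ T * T = S := by
  classical
  exact ⟨CFC.sqrt S, (CFC.sqrt_nonneg S).posSemidef.isHermitian, CFC.sqrt_mul_sqrt_self S hS.nonneg⟩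

variable {S W Y : Matrix m m ℝ}

theorem trace_mul_le_trace_mul_trace (hS : S.PosSemidef) (hW : W.PosSemidef) :
    (S * W).trace ≤ S.trace * W.trace := by
  obtain ⟨T, hT, rfl⟩ := exists_isHermitian_mul_self_eq hS
  obtain ⟨B, hB, rfl⟩ := exists_isHermitian_mul_self_eq hW
  have h := trace_conjTranspose_mul_self_mul_le T B
  rwa [conjTranspose_mul, hT, hB, Matrix.mul_assoc, Matrix.trace_mul_comm, ← Matrix.mul_assoc,
    Matrix.mul_assoc] at h

theorem trace_le_trace_mul_mul_trace_inv [DecidableEq m] (hS : S.PosSemidef) (hY : Y.PosDef) :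
    S.trace ≤ (S * Y).trace * Y⁻¹.trace := by
  have hdet := (Matrix.isUnit_iff_isUnit_det _).1 hY.isUnit
  obtain ⟨T, hT, rfl⟩ := exists_isHermitian_mul_self_eq hS
  obtain ⟨B, hB, rfl⟩ := exists_isHermitian_mul_self_eq hY.posSemidef
  rw [Matrix.det_mul] at hdet
  have h := trace_conjTranspose_mul_self_mul_le (T * B) B⁻¹
  rwa [Matrix.mul_nonsing_inv_cancel_right _ _ (isUnit_of_mul_isUnit_left hdet),
    conjTranspose_mul, Matrix.conjTranspose_nonsing_inv, hT, hB, ← Matrix.mul_inv_rev,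
    Matrix.mul_assoc, Matrix.trace_mul_comm B, ← Matrix.mul_assoc, Matrix.mul_assoc] at h

theorem trace_mul_nonneg (hS : S.PosSemidef) (hW : W.PosSemidef) : 0 ≤ (S * W).trace := by
  obtain ⟨T, hT, rfl⟩ := exists_isHermitian_mul_self_eq hS
  have h := (hW.conjTranspose_mul_mul_same T).trace_nonneg
  rwa [hT, Matrix.trace_mul_comm, ← Matrix.mul_assoc] at h

theorem trace_mul_le_trace_mul_of_trace_le [DecidableEq m] {C : ℝ} (hC : 0 < C) (hS : S.PosSemidef)
    (hW : W.PosSemidef) (hWC : W.trace ≤ C⁻¹) (hY : Y.PosDef) (hYC : Y⁻¹.trace ≤ C) :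
    (S * W).trace ≤ (S * Y).trace :=
  calc (S * W).trace ≤ S.trace * W.trace := trace_mul_le_trace_mul_trace hS hW
    _ ≤ S.trace * C⁻¹ := mul_le_mul_of_nonneg_left hWC hS.trace_nonneg
    _ ≤ (S * Y).trace * C * C⁻¹ := by
        gcongr
        exact (trace_le_trace_mul_mul_trace_inv hS hY).trans
          (mul_le_mul_of_nonneg_left hYC (trace_mul_nonneg hS hY.posSemidef))
    _ = (S * Y).trace := mul_inv_cancel_right₀ hC.ne' _

theorem abs_apply_le_trace (hW : W.PosSemidef) (i j : m) :
    |W i j| ≤ W.trace := by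
  refine abs_le_of_sq_le_sq ?_ hW.trace_nonneg
  calc W i j ^ 2 ≤ ∑ i, ∑ j, W i j ^ 2 :=
        (Finset.single_le_sum (f := fun j => W i j ^ 2) (fun _ _ => sq_nonneg _)
          (Finset.mem_univ j)).trans (Finset.single_le_sum (f := fun i => ∑ j, W i j ^ 2)
            (fun _ _ => Finset.sum_nonneg fun _ _ => sq_nonneg _) (Finset.mem_univ i))
    _ = (W * W).trace := by rw [← trace_conjTranspose_mul_self, hW.isHermitian]
    _ ≤ W.trace ^ 2 := (trace_mul_le_trace_mul_trace hW hW).trans_eq (sq _).symm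

end Trace

section Fourier

variable {n : ℕ}

theorem norm_fourierExp (S : Matrix (Fin n) (Fin n) ℝ) (Z : SiegelSpace n) :
    ‖fourierExp S Z‖ = Real.exp (-(2 * Real.pi * (S * imPart Z).trace)) := by
  have h : (S.map ((↑) : ℝ → ℂ) * (Z : Matrix (Fin n) (Fin n) ℂ)).trace.im =
      (S * imPart Z).trace := by
    simp [Matrix.trace, Matrix.mul_apply, imPart]
  rw [fourierExp, Complex.norm_exp, ← h]
  simp [mul_assoc]

theorem abs_entryMonomial_le {V W : Matrix (Fin n) (Fin n) ℝ} (h : ∀ i j, |V i j| ≤ W i j)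
    (b : UpperIndex n → ℕ) : |entryMonomial V b| ≤ |entryMonomial W b| := by
  simp only [entryMonomial, Finset.abs_prod, abs_pow]
  exact Finset.prod_le_prod (fun _ _ => by positivity) fun q _ =>
    pow_le_pow_left₀ (abs_nonneg _) ((h _ _).trans (le_abs_self _)) _

theorem exists_imPart_eq {Y : Matrix (Fin n) (Fin n) ℝ} (hY : Y.PosDef) :
    ∃ Z : SiegelSpace n, imPart Z = Y := by
  let Z := Complex.I • Y.map ((↑) : ℝ → ℂ)
  have him : Z.map Complex.im = Y := by
    ext i j
    simp [Z]
  have hZ : Zᵀ = Z := by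
    rw [transpose_smul, ← transpose_map, ← conjTranspose_eq_transpose_of_trivial,
      hY.isHermitian]
  exact ⟨⟨Z, hZ, him.symm ▸ hY⟩, him⟩

/-- A point whose Fourier series dominates, term by term, those at all `Z` with `Tr(Y⁻¹) ≤ C`. -/
theorem exists_dominating_point (n : ℕ) {C : ℝ} (hC : 0 < C) : ∃ Z₀ : SiegelSpace n,
    (∀ i j, C ≤ (imPart Z₀)⁻¹ i j) ∧ (imPart Z₀).trace ≤ C⁻¹ := by
  let W : Matrix (Fin n) (Fin n) ℝ := 1 + vecMulVec 1 1
  have hW : W.PosDef :=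
    PosDef.one.add_posSemidef (by simpa using posSemidef_vecMulVec_self_star (1 : Fin n → ℝ))
  have hτ : 0 ≤ W⁻¹.trace := hW.inv.posSemidef.trace_nonneg
  have hD : 0 < C * (1 + W⁻¹.trace) := by positivity
  obtain ⟨Z₀, hZ₀⟩ := exists_imPart_eq (hW.inv.smul (inv_pos.2 hD))
  refine ⟨Z₀, fun i j => ?_, ?_⟩
  · have hinv : (imPart Z₀)⁻¹ = (C * (1 + W⁻¹.trace)) • W := by
      rw [hZ₀]
      refine Matrix.inv_eq_right_inv ?_
      rw [smul_mul_smul_comm, inv_mul_cancel₀ hD.ne', one_smul,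
        Matrix.nonsing_inv_mul _ ((Matrix.isUnit_iff_isUnit_det _).1 hW.isUnit)]
    have hij : 1 ≤ W i j := by simp [W, Matrix.one_apply, apply_ite]
    rw [hinv, Matrix.smul_apply, smul_eq_mul, mul_assoc]
    exact le_mul_of_one_le_right hC.le
      (one_le_mul_of_one_le_of_one_le (le_add_of_nonneg_right hτ) hij)
  · rw [hZ₀, Matrix.trace_smul, smul_eq_mul, mul_inv, mul_assoc]
    refine mul_le_of_le_one_right (inv_nonneg.2 hC.le) ?_
    exact inv_mul_le_one_of_le₀ (le_add_of_nonneg_left zero_le_one) (by positivity)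

theorem HasNiceFourierExpansion.exists_bound {p : ℕ} {f : SiegelSpace n → ℂ}
    (hf : HasNiceFourierExpansion p f) (C : ℝ) :
    ∃ B : ℝ, ∀ Z, (imPart Z)⁻¹.trace ≤ C → ‖f Z‖ ≤ B := by
  obtain ⟨N, -, a, hsum, hunif⟩ := hf
  have hC : 0 < max C 1 := by positivity
  obtain ⟨Z₀, hentry, htrace⟩ := exists_dominating_point n hC
  refine ⟨∑' q : exponents n p × fourierIndex n N,
    ‖a q.1 q.2 * fourierExp q.2.1 Z₀ * (entryMonomial (imPart Z₀)⁻¹ q.1 : ℂ)‖, fun Z hZ => ?_⟩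
  replace hZ := hZ.trans (le_max_left C 1)
  rw [← ((hunif {Z} isCompact_singleton).hasSum (Set.mem_singleton Z)).tsum_eq]
  refine tsum_of_norm_bounded (hsum Z₀).hasSum fun ⟨b, S⟩ => ?_
  have hinv : ∀ i j, |(imPart Z)⁻¹ i j| ≤ (imPart Z₀)⁻¹ i j := fun i j =>
    ((abs_apply_le_trace (imPart_posDef Z).inv.posSemidef i j).trans hZ).trans (hentry i j)
  have hexp : (S.1 * imPart Z₀).trace ≤ (S.1 * imPart Z).trace :=
    trace_mul_le_trace_mul_of_trace_le hC S.2.2 (imPart_posDef Z₀).posSemidef htrace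
      (imPart_posDef Z) hZ
  simp only [norm_mul, Complex.norm_real, norm_fourierExp]
  gcongr
  exact abs_entryMonomial_le hinv b

theorem exists_bound_of_fourierExpansion {V : Type*} [NormedAddCommGroup V] [NormedSpace ℂ V]
    [FiniteDimensional ℂ V] {F : SiegelSpace n → V}
    (hF : ∀ l : Module.Dual ℂ V, ∃ p, HasNiceFourierExpansion p fun Z => l (F Z)) (C : ℝ) :
    ∃ B : ℝ, ∀ Z, (imPart Z)⁻¹.trace ≤ C → ‖F Z‖ ≤ B := by
  let e := Module.finBasis ℂ V
  choose p hp using fun i => hF (e.coord i)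
  choose B hB using fun i => (hp i).exists_bound C
  refine ⟨∑ i, B i * ‖e i‖, fun Z hZ => ?_⟩
  conv_lhs => rw [← e.sum_repr (F Z)]
  refine norm_sum_le_of_le _ fun i _ => ?_
  rw [norm_smul]
  exact mul_le_mul_of_nonneg_right (hB i Z hZ) (norm_nonneg _)

end Fourier

theorem finite_image_of_relIndex_ne_zero {G X : Type*} [Group G] {Γ H : Subgroup G} {f : G → X}
    (hf : ∀ γ ∈ Γ, ∀ g, f (γ * g) = f g) (hΓ : Γ.relIndex H ≠ 0) : (f '' H).Finite := by
  have : (Γ.subgroupOf H).FiniteIndex := ⟨hΓ⟩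
  refine (Set.finite_range fun q : H ⧸ Γ.subgroupOf H => f (q.out : G)⁻¹).subset ?_
  rintro _ ⟨g, hg, rfl⟩
  obtain ⟨γ, hγ⟩ := QuotientGroup.mk_out_eq_mul (Γ.subgroupOf H) (⟨g, hg⟩⁻¹ : H)
  refine ⟨(⟨g, hg⟩⁻¹ : H), ?_⟩
  change f ((Quotient.out _ : H) : G)⁻¹ = f g
  rw [hγ]
  simpa using hf _ (Γ.inv_mem (Subgroup.mem_subgroupOf.1 γ.2)) g

theorem exists_uniform_bound {n : ℕ} {V : Type*} [NormedAddCommGroup V] [NormedSpace ℂ V]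
    [FiniteDimensional ℂ V] {ρ : Representation ℂ (GL (Fin n) ℂ) V} {F : SiegelSpace n → V}
    {Γ : Subgroup (symplecticGroup (Fin n) ℚ)} (hΓ : Γ.relIndex (integralSymplectic n) ≠ 0)
    (hinv : ∀ γ ∈ Γ, slash ρ F (ratToReal n γ) = F)
    (hfourier : ∀ g ∈ integralSymplectic n, ∀ l : Module.Dual ℂ V,
      ∃ p, HasNiceFourierExpansion p fun Z => l (slash ρ F (ratToReal n g) Z)) (C : ℝ) :
    ∃ B : ℝ, ∀ g ∈ integralSymplectic n, ∀ Z, (imPart Z)⁻¹.trace ≤ C →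
      ‖slash ρ F (ratToReal n g) Z‖ ≤ B := by
  have hfin : ((fun g => slash ρ F (ratToReal n g)) '' integralSymplectic n).Finite :=
    finite_image_of_relIndex_ne_zero (fun γ hγ g => by rw [map_mul, slash_mul, hinv γ hγ]) hΓ
  have hbound : ∀ F' ∈ (fun g => slash ρ F (ratToReal n g)) '' integralSymplectic n,
      ∃ B : ℝ, ∀ Z, (imPart Z)⁻¹.trace ≤ C → ‖F' Z‖ ≤ B := by
    rintro _ ⟨g, hg, rfl⟩
    exact exists_bound_of_fourierExpansion (hfourier g hg) C
  choose! B hB using hbound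
  obtain ⟨M, hM⟩ := (hfin.image B).bddAbove
  refine ⟨M, fun g hg Z hZ => ?_⟩
  have hmem := Set.mem_image_of_mem (fun g => slash ρ F (ratToReal n g)) hg
  exact (hB _ hmem Z hZ).trans (hM (Set.mem_image_of_mem B hmem))

/-! ### The determinant in terms of the eigenvalues of `Y` -/

theorem one_le_rpow_add_rpow_neg {μ : ℝ} (hμ : 0 < μ) (x : ℝ) : 1 ≤ μ ^ x + μ ^ (-x) := by
  have hpos (y : ℝ) : 0 < μ ^ y := Real.rpow_pos_of_pos hμ y
  have hinv : μ ^ x * μ ^ (-x) = 1 := by rw [← Real.rpow_add hμ, add_neg_cancel, Real.rpow_zero]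
  nlinarith [hpos x, hpos (-x), sq_nonneg (μ ^ x - μ ^ (-x))]

theorem sqrt_div_min_pow_le {μ : ℝ} (hμ : 0 < μ) (k : ℕ) :
    (√μ / min μ 1) ^ k ≤ μ ^ ((k : ℝ) / 2) + μ ^ (-((k : ℝ) / 2)) := by
  have hsqrt : √μ ^ k = μ ^ ((k : ℝ) / 2) := by
    rw [Real.sqrt_eq_rpow, ← Real.rpow_mul_natCast hμ.le, one_div_mul_eq_div]
  rcases le_total μ 1 with h | h
  · rw [min_eq_left h, Real.sqrt_div_self', one_div, inv_pow, hsqrt, ← Real.rpow_neg hμ.le]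
    exact le_add_of_nonneg_left (by positivity)
  · rw [min_eq_right h, div_one, hsqrt]
    exact le_add_of_nonneg_right (by positivity)

variable {n : ℕ}

theorem norm_det_posDefSqrt {Y : Matrix (Fin n) (Fin n) ℝ} (hY : Y.PosDef) :
    ‖(posDefSqrt Y hY : Matrix (Fin n) (Fin n) ℂ).det‖ =
      ∏ i, √(hY.isHermitian.eigenvalues i) := by
  have hdet : (Y.map ((↑) : ℝ → ℂ)).det = ((Y.det : ℝ) : ℂ) := (Complex.ofRealHom.map_det Y).symm
  refine (mul_self_inj (norm_nonneg _) (by positivity)).1 ?_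
  rw [← norm_mul, ← Matrix.det_mul, posDefSqrt_mul_self, hdet, Complex.norm_real,
    Real.norm_of_nonneg hY.det_pos.le, hY.isHermitian.det_eq_prod_eigenvalues,
    ← Finset.prod_mul_distrib]
  exact Finset.prod_congr rfl fun i _ => (Real.mul_self_sqrt (hY.eigenvalues_pos i).le).symm

theorem norm_det_sqrtFactor (g : symplecticGroup (Fin n) ℝ) (Z : SiegelSpace n) :
    ‖(sqrtFactor g Z).val.det‖ =
      (∏ i, √((imPart_posDef Z).isHermitian.eigenvalues i)) / ‖(denomMatrix g Z).det‖ := by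
  have hJ : (autFactor g Z)⁻¹.val = (denomMatrix g Z)⁻¹ := Matrix.coe_units_inv _
  rw [sqrtFactor, Units.val_mul, Matrix.det_mul, norm_mul, norm_det_posDefSqrt, hJ,
    Matrix.det_nonsing_inv, Ring.inverse_eq_inv', norm_inv, div_eq_mul_inv]

theorem norm_det_sqrtFactor_pow_le (γ : symplecticGroup (Fin n) ℤ) (Z : SiegelSpace n) (k : ℕ) :
    ‖(sqrtFactor (intToReal n γ) Z).val.det‖ ^ k ≤ ((2 * (1 + (n : ℝ))) ^ n) ^ k *
      ∏ i, ((imPart_posDef Z).isHermitian.eigenvalues i ^ ((k : ℝ) / 2) +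
        (imPart_posDef Z).isHermitian.eigenvalues i ^ (-((k : ℝ) / 2))) := by
  set μ := (imPart_posDef Z).isHermitian.eigenvalues
  have hμ (i : Fin n) : 0 < μ i := (imPart_posDef Z).eigenvalues_pos i
  have hmin (i : Fin n) : 0 < min (μ i) 1 := lt_min (hμ i) one_pos
  have hdet : ‖(sqrtFactor (intToReal n γ) Z).val.det‖ ≤
      (2 * (1 + (n : ℝ))) ^ n * ∏ i, (√(μ i) / min (μ i) 1) :=
    calc ‖(sqrtFactor (intToReal n γ) Z).val.det‖
        ≤ (∏ i, √(μ i)) / ((2 * (1 + (n : ℝ)))⁻¹ ^ n * ∏ i, min (μ i) 1) := by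
          rw [norm_det_sqrtFactor]
          have := Finset.prod_pos fun i (_ : i ∈ Finset.univ) => hmin i
          gcongr
          exact prod_min_le_norm_det_denomMatrix γ Z
      _ = _ := by
          rw [inv_pow, Finset.prod_div_distrib, div_mul_eq_div_div, div_inv_eq_mul]
          ring
  calc ‖(sqrtFactor (intToReal n γ) Z).val.det‖ ^ k
      ≤ ((2 * (1 + (n : ℝ))) ^ n * ∏ i, (√(μ i) / min (μ i) 1)) ^ k := by gcongr
    _ = ((2 * (1 + (n : ℝ))) ^ n) ^ k * ∏ i, (√(μ i) / min (μ i) 1) ^ k := by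
        rw [mul_pow, Finset.prod_pow]
    _ ≤ _ := by
        gcongr with i
        · exact fun i _ => pow_nonneg (div_nonneg (Real.sqrt_nonneg _) (hmin i).le) k
        · exact sqrt_div_min_pow_le (hμ i) k

theorem norm_det_inv_pow_le {K : ℝ} {h : GL (Fin n) ℂ} (hK : ∀ i j, ‖h⁻¹.val i j‖ ≤ K) (k : ℕ) :
    ‖h.val.det‖⁻¹ ^ k ≤ (n.factorial • K ^ n) ^ k := by
  have hdet : ‖h⁻¹.val.det‖ ≤ n.factorial • K ^ n := by
    have hle := Matrix.det_le (A := h⁻¹.val) (abv := NormedField.toAbsoluteValue ℂ) hK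
    rwa [Fintype.card_fin] at hle
  rw [Matrix.coe_units_inv, Matrix.det_nonsing_inv, Ring.inverse_eq_inv', norm_inv] at hdet
  exact pow_le_pow_left₀ (by positivity) hdet k

theorem exists_norm_det_sqrtFactor_zpow_le (n : ℕ) (m : ℤ) (K : ℝ) :
    ∃ D : ℝ, ∀ (γ : symplecticGroup (Fin n) ℤ) (Z : SiegelSpace n),
      (∀ i j, ‖(sqrtFactor (intToReal n γ) Z)⁻¹.val i j‖ ≤ K) →
        ‖(sqrtFactor (intToReal n γ) Z).val.det‖ ^ m ≤
          D * ∏ i, ((imPart_posDef Z).isHermitian.eigenvalues i ^ ((m : ℝ) / 2) +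
            (imPart_posDef Z).isHermitian.eigenvalues i ^ (-((m : ℝ) / 2))) := by
  rcases Int.eq_nat_or_neg m with ⟨k, rfl | rfl⟩
  · exact ⟨_, fun γ Z _ => by simpa using norm_det_sqrtFactor_pow_le γ Z k⟩
  · refine ⟨(n.factorial • K ^ n) ^ k, fun γ Z hK => ?_⟩
    rw [_root_.zpow_neg, zpow_natCast, ← inv_pow]
    have hle := norm_det_inv_pow_le hK k
    exact hle.trans (le_mul_of_one_le_right ((by positivity : (0 : ℝ) ≤ _).trans hle)
      (Finset.one_le_prod fun i _ =>
        one_le_rpow_add_rpow_neg ((imPart_posDef Z).eigenvalues_pos i) _))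

end SiegelModular

theorem theorem3p1_general {n : ℕ} {V : Type*} [NormedAddCommGroup V] [NormedSpace ℂ V]
    [FiniteDimensional ℂ V] {ρ : Representation ℂ (GL (Fin n) ℂ) V} (hirr : ρ.IsIrreducible)
    (hnorm : ∀ U : GL (Fin n) ℂ, U.val ∈ unitaryGroup (Fin n) ℂ → ∀ v, ‖ρ U v‖ = ‖v‖)
    {lam : Fin n → ℤ} (hlam : SiegelModular.IsHighestWeight ρ lam) {m : ℤ} (hm : ∀ i, lam i ≤ m)
    {Γ : Subgroup (symplecticGroup (Fin n) ℚ)}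
    (hΓ : Γ.relIndex (SiegelModular.integralSymplectic n) ≠ 0)
    {F : SiegelModular.SiegelSpace n → V}
    (hinv : ∀ γ ∈ Γ, SiegelModular.slash ρ F (SiegelModular.ratToReal n γ) = F)
    (hfourier : ∀ g ∈ SiegelModular.integralSymplectic n, ∀ l : Module.Dual ℂ V,
      ∃ p, SiegelModular.HasNiceFourierExpansion p fun Z =>
        l (SiegelModular.slash ρ F (SiegelModular.ratToReal n g) Z)) :
    ∃ C : ℝ, ∀ Z : SiegelModular.SiegelSpace n,
      ‖ρ (SiegelModular.posDefSqrt (SiegelModular.imPart Z) (SiegelModular.imPart_posDef Z)) (F Z)‖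
        ≤ C * ∏ i : Fin n,
          ((SiegelModular.imPart_posDef Z).isHermitian.eigenvalues i ^ ((m : ℝ) / 2) +
            (SiegelModular.imPart_posDef Z).isHermitian.eigenvalues i ^ (-((m : ℝ) / 2))) := by
  open SiegelModular in
  obtain ⟨R, hR⟩ := exists_reduced_point n
  obtain ⟨B, hB⟩ := exists_uniform_bound hΓ hinv hfourier R
  obtain ⟨C, hC⟩ := exists_norm_apply_le_det_zpow hirr hnorm hlam hm √R
  obtain ⟨D, hD⟩ := exists_norm_det_sqrtFactor_zpow_le n m √R
  refine ⟨|C| * D * B, fun Z => ?_⟩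
  obtain ⟨γ, hγ⟩ := hR Z
  have hentry := norm_inv_sqrtFactor_apply_le hγ
  set F' := slash ρ F (ratToReal n (symplecticMap n (Int.castRingHom ℚ) γ⁻¹)) with hF'
  have hF : F = slash ρ F' (intToReal n γ) := by
    rw [hF', ← ratToReal_symplecticMap, ← slash_mul, ← map_mul, ← map_mul, inv_mul_cancel,
      map_one, hinv 1 Γ.one_mem]
  have hFZ : F Z = slash ρ F' (intToReal n γ) Z := congrFun hF Z
  have hbound : ‖F' (moebius (intToReal n γ) Z)‖ ≤ B := hB _ ⟨γ⁻¹, rfl⟩ _ hγ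
  have hDZ := hD γ Z hentry
  rw [hFZ, slash_eq_sqrtFactor]
  calc _ ≤ C * ‖(sqrtFactor (intToReal n γ) Z).val.det‖ ^ m *
        ‖F' (moebius (intToReal n γ) Z)‖ := hC _ hentry _
    _ ≤ |C| * (D * ∏ i, ((imPart_posDef Z).isHermitian.eigenvalues i ^ ((m : ℝ) / 2) +
          (imPart_posDef Z).isHermitian.eigenvalues i ^ (-((m : ℝ) / 2)))) * B := by
        gcongr
        · exact mul_nonneg (abs_nonneg C) ((zpow_nonneg (norm_nonneg _) m).trans hDZ)
        · exact le_abs_self C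
    _ = _ := by ring

theorem theorem3p1 (n : ℕ) [NeZero n] {V : Type*} [NormedAddCommGroup V] [InnerProductSpace ℂ V]
    [FiniteDimensional ℂ V] (ρ : Representation ℂ (Matrix.GeneralLinearGroup (Fin n) ℂ) V)
    (hrat : SiegelModular.IsRational ρ) (hirr : ρ.IsIrreducible)
    (hinner : ∀ U : Matrix.GeneralLinearGroup (Fin n) ℂ,
      (U : Matrix (Fin n) (Fin n) ℂ) ∈ Matrix.unitaryGroup (Fin n) ℂ →
        ∀ v w : V, inner ℂ (ρ U v) (ρ U w) = inner ℂ v w)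
    (lam : Fin n → ℤ) (hdom : Antitone lam) (hlam : SiegelModular.IsHighestWeight ρ lam)
    (F : SiegelModular.SiegelSpace n → V) (hF : F ∈ SiegelModular.nearlyHolomorphicForms ρ) :
    ∃ C : ℝ, ∀ Z : SiegelModular.SiegelSpace n,
      ‖ρ (SiegelModular.posDefSqrt (SiegelModular.imPart Z) (SiegelModular.imPart_posDef Z)) (F Z)‖
        ≤ C * ∏ i : Fin n,
          ((SiegelModular.imPart_posDef Z).isHermitian.eigenvalues i ^ ((lam 0 : ℝ) / 2) +
            (SiegelModular.imPart_posDef Z).isHermitian.eigenvalues i ^ (-((lam 0 : ℝ) / 2))) := by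
  obtain ⟨Γ, ⟨hcomm, -⟩, p, hform⟩ := hF
  exact theorem3p1_general hirr
    (fun U hU v => by
      rw [@norm_eq_sqrt_re_inner ℂ, @norm_eq_sqrt_re_inner ℂ _ _ _ _ v, hinner U hU])
    hlam (fun i => hdom (Fin.zero_le i)) hcomm.1 hform.invariant
    fun g _ l => ⟨p, hform.fourier g l⟩
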